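/- Let $n,r\ge 0$ be integers. Let $\Lambda(n,r)$ be the set of sequences $\lambda=(\lambda_1,\dots,\lambda_n)$ of nonnegative integers with sum $r$, and let $\Lambda^{\bullet}(n,r)\subseteq\Lambda(n,r)$ consist of those $\lambda$ for which $\lambda_i=0$ implies $\lambda_j=0$ for all $j>i$. Let $M_n(r)$ be the set of $n\times n$ matrices with nonnegative integer entries of total sum $r$; for $A\in M_n(r)$ write $\mathrm{ro}(A),\mathrm{co}(A)\in\Lambda(n,r)$ for its vectors of row sums and column sums. *The algebra.* For $A\in M_n(r)$ and $0\le i,k\le n$ put $\mathrm{ne}_A(i,k)=\sum_{a\le i,\ b>k}A_{a,b}$. Let $\mathbf S_0(n,r)$ be the $0$-Schur algebra over $\mathbb C$, in its realization by relative positions of pairs of $n$-step flags in an $r$-dimensional space: it has the standard basis $\{e_A\mid A\in M_n(r)\}$, with $e_Ae_B=0$ if $\mathrm{co}(A)\ne\mathrm{ro}(B)$, and $e_Ae_B=e_C$ if $\mathrm{co}(A)=\mathrm{ro}(B)$, where $C\in M_n(r)$ is the generic composite of $A$ and $B$, that is, the unique matrix with $\mathrm{ne}_C(i,k)=\min_{0\le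 j\le n}\bigl(\mathrm{ne}_A(i,j)+\mathrm{ne}_B(j,k)\bigr)$ for all $i,k$. The identity is $\sum_{\lambda\in\Lambda(n,r)}k_\lambda$ with $k_\lambda=e_{\mathrm{diag}(\lambda)}$. *The modules $P_\lambda$.* A matrix is *open* if every $2\times 2$ submatrix of it has at least one zero on its diagonal. Let $\alpha$ be a composition of $n$ into positive parts; it cuts $\{1,\dots,n\}$ into consecutive blocks. A matrix $A\in M_n(r)$ is *open on columns with respect to $\alpha$* if, for each block, the matrix obtained from $A$ by replacing all columns outside the block by zero is open. For $\lambda\in\Lambda(n,r)$, $\alpha$ is *maximal with respect to $\lambda$* if each of the subsequences into which $\alpha$ cuts $\lambda$ either equals $(0)$ or has nonzero first and last entries. Let $B^\lambda$ be the set of all $e_A$ such that $\mathrm{co}(A)=\lambda$ and $A$ is not open on columns with respect to any $\alpha\neq(1,\dots,1)$ that is maximal with respect to $\lambda$. Let $P_\lambda$ be the $\mathbf S_0(n,r)$-module with $\mathbb C$-basis $B^\lambda$ in which $e_C\cdot e_A$ is the product $e_Ce_A$ if this product lies in $B^\lambda$, and $0$ otherwise. *The submodule $N_\lambda$.* A matrix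 $A$ is *column block diagonal* if $A_{i,j}>0$ implies $A_{i',j'}=0$ for all $i'\le i$ and $j'>j$. Let $\beta^\lambda$ be the set of all $e_A$ with $A$ column block diagonal and $\mathrm{co}(A)=\lambda$. Let $N_\lambda$ be the $\mathbb C$-span of $B^\lambda\setminus\beta^\lambda$, which is a submodule of $P_\lambda$, and let $S_\lambda=P_\lambda/N_\lambda$. For a module $M$ let $\mathrm{rad}(M)$ be the intersection of its maximal submodules and $\mathrm{top}(M)=M/\mathrm{rad}(M)$. **Claim.** For every $\lambda\in\Lambda^{\bullet}(n,r)$ one has $N_\lambda=\mathrm{rad}(P_\lambda)$. Equivalently, $S_\lambda=\mathrm{top}(P_\lambda)$: there is an isomorphism of $\mathbf S_0(n,r)$-modules $S_\lambda\to\mathrm{top}(P_\lambda)$ that sends $x+N_\lambda$ to $x+\mathrm{rad}(P_\lambda)$ for every $x\in P_\lambda$. -/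

import Mathlib

namespace SchurZero

/-! ### Weak compositions and nonnegative integer matrices -/

/-- Weak compositions of `r` of length `n`. -/
def WeakComp (n r : ℕ) : Type := {l : Fin n → ℕ // ∑ i, l i = r}

instance (n r : ℕ) : Fintype (WeakComp n r) :=
  Fintype.subtype (Finset.Nat.antidiagonalTuple n r)
    (fun _ => Finset.Nat.mem_antidiagonalTuple)

instance (n r : ℕ) : DecidableEq (WeakComp n r) :=
  inferInstanceAs (DecidableEq {l : Fin n → ℕ // ∑ i, l i = r})

/-- `l i = 0` implies `l j = 0` for all `j > i`. -/
def WeakComp.IsBullet {n r : ℕ} (l : WeakComp n r) : Prop :=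
  ∀ i, l.1 i = 0 → ∀ j, i < j → l.1 j = 0

/-- `n × n` matrices of nonnegative integers with total sum of entries `r`. -/
def Mat (n r : ℕ) : Type := {A : Matrix (Fin n) (Fin n) ℕ // ∑ i, ∑ j, A i j = r}

/-- The row-sum vector. -/
def ro {n r : ℕ} (A : Mat n r) : WeakComp n r := ⟨fun i => ∑ j, A.1 i j, A.2⟩

/-- The column-sum vector. -/
def co {n r : ℕ} (A : Mat n r) : WeakComp n r :=
  ⟨fun j => ∑ i, A.1 i j, by rw [Finset.sum_comm]; exact A.2⟩

/-- The diagonal matrix with diagonal `l`. -/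
def diagMat {n r : ℕ} (l : WeakComp n r) : Mat n r :=
  ⟨Matrix.diagonal l.1, by
    have : ∀ i : Fin n, ∑ j, Matrix.diagonal l.1 i j = l.1 i := fun i => by
      simp [Matrix.diagonal_apply]
    simp only [this]; exact l.2⟩

/-! ### The product of two matrices: generic composition of relative positions -/

/-- The north-east corner sum: the sum of the entries in the first `i` rows that do not lie in the
first `k` columns. If two `n`-step flags `f`, `h` of an `r`-dimensional space are in relative
position `A`, this is the dimension of `f_i / (f_i ∩ h_k)`. -/
def ne {n : ℕ} (A : Matrix (Fin n) (Fin n) ℕ) (i k : ℕ) : ℕ :=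
  ∑ a : Fin n, ∑ b : Fin n, if (a : ℕ) < i ∧ k ≤ (b : ℕ) then A a b else 0

/-- `min_{0 ≤ j ≤ n} (ne A i j + ne B j k)`. For flags `f`, `g`, `h` with `(f, g)` in relative
position `A` and `(g, h)` in relative position `B`, this is the largest (that is, the generic)
value of `dim f_i / (f_i ∩ h_k)`. -/
def minPlus {n : ℕ} (A B : Matrix (Fin n) (Fin n) ℕ) (i k : ℕ) : ℕ :=
  (Finset.range (n + 1)).inf' ⟨0, by simp⟩ (fun j => ne A i j + ne B j k)

/-- The matrix whose north-east corner sums are `minPlus A B`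
(for `A`, `B` such that the column sums of `A` are the row sums of `B`). -/
def prodMat {n : ℕ} (A B : Matrix (Fin n) (Fin n) ℕ) : Matrix (Fin n) (Fin n) ℕ :=
  fun a b => minPlus A B (a + 1) b + minPlus A B a (b + 1)
    - (minPlus A B a b + minPlus A B (a + 1) (b + 1))

/-- Sum over the rectangle of rows `i ≤ a < i'` and columns `k ≤ b < k'`. -/
def rect {n : ℕ} (A : Matrix (Fin n) (Fin n) ℕ) (i i' k k' : ℕ) : ℕ :=
  ∑ a : Fin n, ∑ b : Fin n,
    if i ≤ (a : ℕ) ∧ (a : ℕ) < i' ∧ k ≤ (b : ℕ) ∧ (b : ℕ) < k' then A a b else 0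

theorem rect_add_ne {n : ℕ} (A : Matrix (Fin n) (Fin n) ℕ) {i i' k k' : ℕ}
    (hi : i ≤ i') (hk : k ≤ k') :
    rect A i i' k k' + (ne A i k + ne A i' k') = ne A i' k + ne A i k' := by
  simp only [rect, ne, ← Finset.sum_add_distrib]
  refine Finset.sum_congr rfl fun a _ => Finset.sum_congr rfl fun b _ => ?_
  split_ifs <;> omega

theorem rect_eq_zero {n : ℕ} (A : Matrix (Fin n) (Fin n) ℕ) {i i' k k' : ℕ} :
    rect A i i' k k' = 0 ↔ ∀ a b : Fin n, i ≤ (a : ℕ) → (a : ℕ) < i' → k ≤ (b : ℕ) →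
      (b : ℕ) < k' → A a b = 0 := by
  simp only [rect, Finset.sum_eq_zero_iff, Finset.mem_univ, true_implies, ite_eq_right_iff,
    and_imp]

theorem rect_single {n : ℕ} (A : Matrix (Fin n) (Fin n) ℕ) (a b : Fin n) :
    rect A a (a + 1) b (b + 1) = A a b := by
  unfold rect
  rw [Finset.sum_eq_single a, Finset.sum_eq_single b]
  · simp
  · intro b' _ hb
    rw [if_neg]; intro h; exact hb (Fin.ext (by omega))
  · simp
  · intro a' _ ha
    refine Finset.sum_eq_zero fun b' _ => if_neg ?_
    intro h; exact ha (Fin.ext (by omega))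
  · simp

theorem ne_zero_left {n : ℕ} (A : Matrix (Fin n) (Fin n) ℕ) (k : ℕ) : ne A 0 k = 0 := by
  simp [ne]

theorem ne_last {n : ℕ} (A : Matrix (Fin n) (Fin n) ℕ) (i : ℕ) : ne A i n = 0 := by
  simp only [ne, Finset.sum_eq_zero_iff, Finset.mem_univ, true_implies, ite_eq_right_iff]
  intro a b h; have := b.2; omega

theorem ne_entry {n : ℕ} (A : Matrix (Fin n) (Fin n) ℕ) (a b : Fin n) :
    A a b + (ne A a b + ne A (a + 1) (b + 1)) = ne A (a + 1) b + ne A a (b + 1) := by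
  rw [← rect_single A a b]; exact rect_add_ne A (by omega) (by omega)

theorem ne_monge {n : ℕ} (A : Matrix (Fin n) (Fin n) ℕ) {i i' k k' : ℕ}
    (hi : i ≤ i') (hk : k ≤ k') : ne A i k + ne A i' k' ≤ ne A i' k + ne A i k' := by
  have := rect_add_ne A hi hk; omega

theorem ne_row {n r : ℕ} (A : Mat n r) (a : Fin n) :
    ne A.1 (a + 1) 0 = ne A.1 a 0 + (ro A).1 a := by
  have h := rect_add_ne A.1 (Nat.le_succ (a : ℕ)) (Nat.zero_le n)
  have h2 : rect A.1 a (a + 1) 0 n = (ro A).1 a := by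
    unfold rect
    rw [Finset.sum_eq_single a]
    · simp [ro]
    · intro a' _ ha
      refine Finset.sum_eq_zero fun b' _ => if_neg ?_
      intro h; exact ha (Fin.ext (by omega))
    · simp
  simp only [ne_last, Nat.succ_eq_add_one] at h
  omega

theorem ne_col {n r : ℕ} (A : Mat n r) (b : Fin n) :
    ne A.1 n b = (co A).1 b + ne A.1 n (b + 1) := by
  have h := rect_add_ne A.1 (Nat.zero_le n) (Nat.le_succ (b : ℕ))
  have h2 : rect A.1 0 n b (b + 1) = (co A).1 b := by
    unfold rect co
    refine Finset.sum_congr rfl fun a _ => ?_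
    rw [Finset.sum_eq_single b]
    · simp
    · intro b' _ hb
      rw [if_neg]; intro h; exact hb (Fin.ext (by omega))
    · simp
  simp only [ne_zero_left, Nat.succ_eq_add_one] at h
  omega

theorem ne_full {n : ℕ} (A : Matrix (Fin n) (Fin n) ℕ) : ne A n 0 = ∑ i, ∑ j, A i j := by
  simp [ne]

theorem ne_full' {n r : ℕ} (A : Mat n r) : ne A.1 n 0 = r := by rw [ne_full]; exact A.2

/-- A matrix is determined by its corner sums. -/
theorem ne_inj {n : ℕ} {A B : Matrix (Fin n) (Fin n) ℕ}
    (h : ∀ i k, i ≤ n → k ≤ n → ne A i k = ne B i k) : A = B := by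
  ext a b
  have h1 := ne_entry A a b
  have h2 := ne_entry B a b
  rw [h _ _ (by omega) (by omega), h _ _ (by omega) (by omega), h _ _ (by omega) (by omega),
    h _ _ (by omega) (by omega)] at h1
  omega

theorem ne_compl {n r : ℕ} {A B : Mat n r} (h : co A = ro B) {j : ℕ} (hj : j ≤ n) :
    ne A.1 n j + ne B.1 j 0 = r := by
  induction j with
  | zero => rw [ne_full', ne_zero_left]; rfl
  | succ j ih =>
    have h1 := ne_col A ⟨j, hj⟩
    have h2 := ne_row B ⟨j, hj⟩
    rw [h] at h1
    have := ih (by omega)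
    simp only at h1 h2
    omega

/-- The matrix with prescribed corner sums. -/
theorem ne_of_monge {n : ℕ} (m : ℕ → ℕ → ℕ) (C : Matrix (Fin n) (Fin n) ℕ)
    (h0 : ∀ k, k ≤ n → m 0 k = 0) (hn : ∀ i, i ≤ n → m i n = 0)
    (hC : ∀ a b : Fin n, C a b + (m a b + m (a + 1) (b + 1)) = m (a + 1) b + m a (b + 1)) :
    ∀ i k, i ≤ n → k ≤ n → ne C i k = m i k := by
  intro i
  induction i with
  | zero => intro k _ hk; rw [ne_zero_left, h0 k hk]
  | succ i ih =>
    intro k hi hk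
    refine Nat.decreasingInduction (motive := fun k _ => ne C (i + 1) k = m (i + 1) k)
      (fun k hk ihk => ?_) ?_ hk
    · have h1 := ne_entry C ⟨i, hi⟩ ⟨k, hk⟩
      have h2 := hC ⟨i, hi⟩ ⟨k, hk⟩
      have h3 := ih k (by omega) hk.le
      have h4 := ih (k + 1) (by omega) hk
      simp only at h1 h2
      omega
    · rw [ne_last, hn _ hi]

theorem minPlus_le {n : ℕ} (A B : Matrix (Fin n) (Fin n) ℕ) (i k : ℕ) {j : ℕ} (hj : j ≤ n) :
    minPlus A B i k ≤ ne A i j + ne B j k :=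
  Finset.inf'_le (fun j => ne A i j + ne B j k) (Finset.mem_range.2 (Nat.lt_succ_of_le hj))

theorem minPlus_exists {n : ℕ} (A B : Matrix (Fin n) (Fin n) ℕ) (i k : ℕ) :
    ∃ j, j ≤ n ∧ minPlus A B i k = ne A i j + ne B j k := by
  obtain ⟨j, hj, h⟩ := Finset.exists_mem_eq_inf' (s := Finset.range (n + 1)) ⟨0, by simp⟩
    (fun j => ne A i j + ne B j k)
  exact ⟨j, Nat.lt_succ_iff.1 (Finset.mem_range.1 hj), h⟩

theorem minPlus_monge {n : ℕ} (A B : Matrix (Fin n) (Fin n) ℕ) (i k : ℕ) :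
    minPlus A B i k + minPlus A B (i + 1) (k + 1)
      ≤ minPlus A B (i + 1) k + minPlus A B i (k + 1) := by
  obtain ⟨j, hj, h1⟩ := minPlus_exists A B (i + 1) k
  obtain ⟨l, hl, h2⟩ := minPlus_exists A B i (k + 1)
  have a1 := minPlus_le A B i k hj
  have a2 := minPlus_le A B i k hl
  have a3 := minPlus_le A B (i + 1) (k + 1) hj
  have a4 := minPlus_le A B (i + 1) (k + 1) hl
  rcases le_total j l with h | h
  · have := ne_monge A (Nat.le_succ i) h
    simp only [Nat.succ_eq_add_one] at this
    omega
  · have := ne_monge B h (Nat.le_succ k)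
    simp only [Nat.succ_eq_add_one] at this
    omega

theorem ne_prodMat {n : ℕ} (A B : Matrix (Fin n) (Fin n) ℕ) :
    ∀ i k, i ≤ n → k ≤ n → ne (prodMat A B) i k = minPlus A B i k := by
  refine ne_of_monge _ _ (fun k _ => ?_) (fun i _ => ?_) (fun a b => ?_)
  · have := minPlus_le A B 0 k (Nat.zero_le n)
    simpa [ne_zero_left] using this
  · have := minPlus_le A B i n le_rfl
    simpa [ne_last] using this
  · have := minPlus_monge A B a b
    simp only [prodMat]
    omega

/-- The generic product of two matrices `A`, `B` with `co A = ro B`. -/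
def prod {n r : ℕ} (A B : Mat n r) (h : co A = ro B) : Mat n r :=
  ⟨prodMat A.1 B.1, by
    rw [← ne_full, ne_prodMat _ _ _ _ le_rfl (Nat.zero_le n)]
    refine le_antisymm ?_ ?_
    · have := minPlus_le A.1 B.1 n 0 (Nat.zero_le n)
      rwa [ne_full', ne_zero_left] at this
    · obtain ⟨j, hj, h1⟩ := minPlus_exists A.1 B.1 n 0
      rw [h1, ne_compl h hj]⟩

theorem ne_prod_le {n r : ℕ} {A B : Mat n r} (h : co A = ro B) {i j k : ℕ} (hi : i ≤ n)
    (hj : j ≤ n) (hk : k ≤ n) : ne (prod A B h).1 i k ≤ ne A.1 i j + ne B.1 j k := by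
  change ne (prodMat _ _) _ _ ≤ _
  rw [ne_prodMat _ _ _ _ hi hk]; exact minPlus_le _ _ _ _ hj

theorem ne_prod_exists {n r : ℕ} {A B : Mat n r} (h : co A = ro B) {i k : ℕ} (hi : i ≤ n)
    (hk : k ≤ n) : ∃ j, j ≤ n ∧ ne (prod A B h).1 i k = ne A.1 i j + ne B.1 j k := by
  change ∃ j, j ≤ n ∧ ne (prodMat _ _) _ _ = _
  rw [ne_prodMat _ _ _ _ hi hk]; exact minPlus_exists _ _ _ _

theorem prod_unique {n r : ℕ} {A B C : Mat n r} (h : co A = ro B)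
    (h1 : ∀ i j k, i ≤ n → j ≤ n → k ≤ n → ne C.1 i k ≤ ne A.1 i j + ne B.1 j k)
    (h2 : ∀ i k, i ≤ n → k ≤ n → ∃ j, j ≤ n ∧ ne A.1 i j + ne B.1 j k ≤ ne C.1 i k) :
    prod A B h = C := by
  refine Subtype.ext (ne_inj fun i k hi hk => le_antisymm ?_ ?_)
  · obtain ⟨j, hj, hh⟩ := h2 i k hi hk
    exact (ne_prod_le h hi hj hk).trans hh
  · obtain ⟨j, hj, hh⟩ := ne_prod_exists h hi hk
    rw [hh]; exact h1 i j k hi hj hk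

theorem ne_prod_row {n r : ℕ} {A B : Mat n r} (h : co A = ro B) {i : ℕ} (hi : i ≤ n) :
    ne (prod A B h).1 i 0 = ne A.1 i 0 := by
  refine le_antisymm ?_ ?_
  · have := ne_prod_le h hi (Nat.zero_le n) (Nat.zero_le n)
    rwa [ne_zero_left, add_zero] at this
  · obtain ⟨j, hj, hh⟩ := ne_prod_exists h hi (Nat.zero_le n)
    have h1 := ne_compl h hj
    have h2 := ne_monge A.1 hi (Nat.zero_le j)
    have h3 := ne_full' A
    omega

theorem ne_prod_col {n r : ℕ} {A B : Mat n r} (h : co A = ro B) {k : ℕ} (hk : k ≤ n) :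
    ne (prod A B h).1 n k = ne B.1 n k := by
  refine le_antisymm ?_ ?_
  · have := ne_prod_le h le_rfl le_rfl hk
    rwa [ne_last, zero_add] at this
  · obtain ⟨j, hj, hh⟩ := ne_prod_exists h le_rfl hk
    have h1 := ne_compl h hj
    have h2 := ne_monge B.1 hj (Nat.zero_le k)
    have h3 := ne_full' B
    omega

theorem ro_prod {n r : ℕ} {A B : Mat n r} (h : co A = ro B) : ro (prod A B h) = ro A := by
  refine Subtype.ext (funext fun a => ?_)
  have h1 := ne_row (prod A B h) a
  have h2 := ne_row A a
  rw [ne_prod_row h (by omega), ne_prod_row h (by omega)] at h1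
  omega

theorem co_prod {n r : ℕ} {A B : Mat n r} (h : co A = ro B) : co (prod A B h) = co B := by
  refine Subtype.ext (funext fun b => ?_)
  have h1 := ne_col (prod A B h) b
  have h2 := ne_col B b
  rw [ne_prod_col h (by omega), ne_prod_col h (by omega)] at h1
  omega

theorem prod_assoc {n r : ℕ} {A B C : Mat n r} (h : co A = ro B) (h' : co B = ro C)
    (h1 : co (prod A B h) = ro C) (h2 : co A = ro (prod B C h')) :
    prod (prod A B h) C h1 = prod A (prod B C h') h2 := by
  refine prod_unique _ (fun i j k hi hj hk => ?_) (fun i k hi hk => ?_)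
  · obtain ⟨l, hl, e1⟩ := ne_prod_exists h hi hj
    have e2 := ne_prod_le h2 hi hl hk
    have e3 := ne_prod_le h' hl hj hk
    omega
  · obtain ⟨l, hl, e1⟩ := ne_prod_exists h2 hi hk
    obtain ⟨j, hj, e2⟩ := ne_prod_exists h' hl hk
    have e3 := ne_prod_le h hi hl hj
    exact ⟨j, hj, by omega⟩

theorem ne_diag_upper {n r : ℕ} (l : WeakComp n r) {i j : ℕ} (hij : i ≤ j) :
    ne (diagMat l).1 i j = 0 := by
  simp only [ne, Finset.sum_eq_zero_iff, Finset.mem_univ, true_implies, ite_eq_right_iff]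
  intro a b h
  exact Matrix.diagonal_apply_ne _ (fun hab => by subst hab; omega)

theorem ne_diag_lower {n r : ℕ} (l : WeakComp n r) {i j : ℕ} (hij : j ≤ i) :
    ne (diagMat l).1 i j + ne (diagMat l).1 j 0 = ne (diagMat l).1 i 0 := by
  have h := rect_add_ne (diagMat l).1 hij (Nat.zero_le j)
  have h0 : rect (diagMat l).1 j i 0 j = 0 := by
    rw [rect_eq_zero]
    intro a b h1 _ _ h4
    exact Matrix.diagonal_apply_ne _ (fun hab => by subst hab; omega)
  have := ne_diag_upper l (le_refl j)
  omega

theorem ro_diag {n r : ℕ} (l : WeakComp n r) : ro (diagMat l) = l := by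
  refine Subtype.ext (funext fun i => ?_)
  simp [ro, diagMat, Matrix.diagonal_apply]

theorem co_diag {n r : ℕ} (l : WeakComp n r) : co (diagMat l) = l := by
  refine Subtype.ext (funext fun i => ?_)
  simp [co, diagMat, Matrix.diagonal_apply]

theorem ne_row_congr {n r : ℕ} {A B : Mat n r} (h : ro A = ro B) {i : ℕ} (hi : i ≤ n) :
    ne A.1 i 0 = ne B.1 i 0 := by
  induction i with
  | zero => simp [ne_zero_left]
  | succ i ih =>
    have h1 := ne_row A ⟨i, hi⟩
    have h2 := ne_row B ⟨i, hi⟩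
    rw [h] at h1
    have := ih (by omega)
    simp only at h1 h2
    omega

theorem prod_diag_left {n r : ℕ} {A : Mat n r} {l : WeakComp n r} (h : co (diagMat l) = ro A) :
    prod (diagMat l) A h = A := by
  have hl : ro (diagMat l) = ro A := by rw [ro_diag, ← h, co_diag]
  refine prod_unique _ (fun i j k hi hj hk => ?_) (fun i k hi hk => ⟨i, hi, ?_⟩)
  · rcases le_total i j with hij | hij
    · have h1 := ne_monge A.1 hij hk
      rw [ne_last, ne_last] at h1
      omega
    · have h1 := ne_diag_lower l hij
      rw [ne_row_congr hl hi, ne_row_congr hl hj] at h1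
      have h2 := ne_monge A.1 hij (Nat.zero_le k)
      omega
  · rw [ne_diag_upper l le_rfl, zero_add]

theorem prod_diag_right {n r : ℕ} {A : Mat n r} {l : WeakComp n r} (h : co A = ro (diagMat l)) :
    prod A (diagMat l) h = A := by
  refine prod_unique _ (fun i j k hi hj hk => ?_) (fun i k hi hk => ⟨k, hk, ?_⟩)
  · rcases le_total j k with hjk | hjk
    · have h1 := ne_monge A.1 (Nat.zero_le i) hjk
      rw [ne_zero_left, ne_zero_left] at h1
      omega
    · have h1 := ne_diag_lower l hjk
      have h2 := ne_monge A.1 hi hjk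
      have h3 := ne_compl h hj
      have h4 := ne_compl h hk
      omega
  · rw [ne_diag_upper l le_rfl, add_zero]

/-! ### The 0-Schur algebra over `ℂ` -/

/-- The 0-Schur algebra over `ℂ`, in its realization by relative positions of pairs of `n`-step
flags in an `r`-dimensional space: it has the standard basis `e_A`, where `A` runs over the
`n × n` matrices of nonnegative integers with sum `r` (the orbits of pairs of flags), and
`e_A e_B = e_C` with `C` the generic composite of `A` and `B` if `co A = ro B`, and `e_A e_B = 0`
otherwise. The facts `k_mul_e`, `e_mul_k`, `eGen_mul`, `fGen_mul` below are the usual rules for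
the products `k_l e_A`, `e_A k_l`, `e_i e_A` and `f_i e_A`; as the `k_l`, `e_i`, `f_i` generate the
algebra (`adjoin_generators`), these rules determine the multiplication of the standard basis. -/
def Alg (n r : ℕ) : Type := Mat n r →₀ ℂ

noncomputable section

instance (n r : ℕ) : AddCommGroup (Alg n r) := inferInstanceAs (AddCommGroup (Mat n r →₀ ℂ))

instance (n r : ℕ) : Module ℂ (Alg n r) := inferInstanceAs (Module ℂ (Mat n r →₀ ℂ))

/-- The standard basis element `e_A`. -/
def e {n r : ℕ} (A : Mat n r) : Alg n r := Finsupp.single A 1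

/-- The idempotent `k_l = e_{diag l}`. -/
def k {n r : ℕ} (l : WeakComp n r) : Alg n r := e (diagMat l)

/-- The product of two standard basis elements: `e_A e_B = e_C` with `C` the generic product if
`co A = ro B`, and `0` otherwise. -/
def basisMul {n r : ℕ} (A B : Mat n r) : Alg n r :=
  if h : co A = ro B then e (prod A B h) else 0

/-- The bilinear extension of `basisMul`. -/
def mulLin (n r : ℕ) : Alg n r →ₗ[ℂ] Alg n r →ₗ[ℂ] Alg n r :=
  Finsupp.linearCombination ℂ fun A : Mat n r =>
    (Finsupp.linearCombination ℂ fun B : Mat n r => basisMul A B : (Mat n r →₀ ℂ) →ₗ[ℂ] Alg n r)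

instance (n r : ℕ) : Mul (Alg n r) := ⟨fun x y => mulLin n r x y⟩

instance (n r : ℕ) : One (Alg n r) := ⟨∑ l : WeakComp n r, k l⟩

theorem mul_def {n r : ℕ} (x y : Alg n r) : x * y = mulLin n r x y := rfl

theorem one_def (n r : ℕ) : (1 : Alg n r) = ∑ l : WeakComp n r, k l := rfl

theorem e_mul_e {n r : ℕ} (A B : Mat n r) :
    e A * e B = if h : co A = ro B then e (prod A B h) else 0 := by
  have h1 : mulLin n r (e A) = (Finsupp.linearCombination ℂ fun B : Mat n r => basisMul A B :
      (Mat n r →₀ ℂ) →ₗ[ℂ] Alg n r) := by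
    refine (Finsupp.linearCombination_single ℂ (1 : ℂ) A).trans (one_smul _ _)
  rw [mul_def, h1]
  exact (Finsupp.linearCombination_single ℂ (1 : ℂ) B).trans (one_smul _ _)

theorem alg_induction {n r : ℕ} {p : Alg n r → Prop} (x : Alg n r) (h0 : p 0)
    (hadd : ∀ x y, p x → p y → p (x + y)) (hs : ∀ (c : ℂ) (A : Mat n r), p (c • e A)) : p x := by
  refine Finsupp.induction_linear (motive := p) x h0 hadd fun A c => ?_
  have : (Finsupp.single A c : Mat n r →₀ ℂ) = c • Finsupp.single A 1 := by simp
  rw [this]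
  exact hs c A

theorem mul_add' {n r : ℕ} (x y z : Alg n r) : x * (y + z) = x * y + x * z :=
  map_add (mulLin n r x) y z

theorem add_mul' {n r : ℕ} (x y z : Alg n r) : (x + y) * z = x * z + y * z := by
  simp only [mul_def, map_add, LinearMap.add_apply]

theorem smul_mul' {n r : ℕ} (c : ℂ) (x y : Alg n r) : (c • x) * y = c • (x * y) := by
  simp only [mul_def, map_smul, LinearMap.smul_apply]

theorem mul_smul' {n r : ℕ} (c : ℂ) (x y : Alg n r) : x * (c • y) = c • (x * y) :=
  map_smul (mulLin n r x) c y

theorem zero_mul' {n r : ℕ} (x : Alg n r) : 0 * x = 0 := by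
  simp only [mul_def, map_zero, LinearMap.zero_apply]

theorem mul_zero' {n r : ℕ} (x : Alg n r) : x * 0 = 0 := map_zero (mulLin n r x)

theorem e_mul_assoc {n r : ℕ} (A B C : Mat n r) : e A * e B * e C = e A * (e B * e C) := by
  by_cases h : co A = ro B
  · by_cases h' : co B = ro C
    · have h1 : co (prod A B h) = ro C := by rw [co_prod, h']
      have h2 : co A = ro (prod B C h') := by rw [ro_prod, h]
      rw [e_mul_e A B, dif_pos h, e_mul_e B C, dif_pos h', e_mul_e, dif_pos h1, e_mul_e,
        dif_pos h2, prod_assoc]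
    · have h1 : ¬ co (prod A B h) = ro C := by rwa [co_prod]
      rw [e_mul_e A B, dif_pos h, e_mul_e B C, dif_neg h', e_mul_e, dif_neg h1, mul_zero']
  · rw [e_mul_e A B, dif_neg h, zero_mul']
    by_cases h' : co B = ro C
    · have h2 : ¬ co A = ro (prod B C h') := by rwa [ro_prod]
      rw [e_mul_e B C, dif_pos h', e_mul_e, dif_neg h2]
    · rw [e_mul_e B C, dif_neg h', mul_zero']

theorem mul_assoc' {n r : ℕ} (x y z : Alg n r) : x * y * z = x * (y * z) := by
  refine alg_induction (p := fun x => x * y * z = x * (y * z)) x ?_ ?_ ?_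
  · simp only [zero_mul']
  · intro x x' h h'; simp only [add_mul', h, h']
  intro c A
  refine alg_induction (p := fun y => c • e A * y * z = c • e A * (y * z)) y ?_ ?_ ?_
  · simp only [zero_mul', mul_zero']
  · intro x x' h h'; simp only [add_mul', mul_add', h, h']
  intro d B
  refine alg_induction (p := fun z => c • e A * (d • e B) * z = c • e A * (d • e B * z)) z ?_ ?_ ?_
  · simp only [mul_zero']
  · intro x x' h h'; simp only [mul_add', h, h']
  intro f C
  simp only [smul_mul', mul_smul', e_mul_assoc]

theorem k_mul_e {n r : ℕ} (l : WeakComp n r) (A : Mat n r) :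
    k l * e A = if l = ro A then e A else 0 := by
  rw [k, e_mul_e]
  by_cases h : l = ro A
  · have h' : co (diagMat l) = ro A := by rw [co_diag, h]
    rw [dif_pos h', if_pos h, prod_diag_left]
  · rw [dif_neg (by rwa [co_diag]), if_neg h]

theorem e_mul_k {n r : ℕ} (l : WeakComp n r) (A : Mat n r) :
    e A * k l = if l = co A then e A else 0 := by
  rw [k, e_mul_e]
  by_cases h : l = co A
  · have h' : co A = ro (diagMat l) := by rw [ro_diag, h]
    rw [dif_pos h', if_pos h, prod_diag_right]
  · rw [dif_neg (by rw [ro_diag]; exact fun h' => h h'.symm), if_neg h]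

theorem sum_mul' {n r : ℕ} {ι : Type} (s : Finset ι) (f : ι → Alg n r) (x : Alg n r) :
    (∑ i ∈ s, f i) * x = ∑ i ∈ s, f i * x := by
  simp only [mul_def, map_sum, LinearMap.sum_apply]

theorem mul_sum' {n r : ℕ} {ι : Type} (s : Finset ι) (f : ι → Alg n r) (x : Alg n r) :
    x * (∑ i ∈ s, f i) = ∑ i ∈ s, x * f i :=
  map_sum (mulLin n r x) f s

theorem one_mul' {n r : ℕ} (x : Alg n r) : 1 * x = x := by
  refine alg_induction (p := fun x => 1 * x = x) x (mul_zero' _) ?_ ?_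
  · intro x x' h h'; rw [mul_add', h, h']
  · intro c A
    rw [mul_smul', one_def, sum_mul']
    simp [k_mul_e]

theorem mul_one' {n r : ℕ} (x : Alg n r) : x * 1 = x := by
  refine alg_induction (p := fun x => x * 1 = x) x (zero_mul' _) ?_ ?_
  · intro x x' h h'; rw [add_mul', h, h']
  · intro c A
    rw [smul_mul', one_def, mul_sum']
    simp [e_mul_k]

instance (n r : ℕ) : Ring (Alg n r) :=
  { (inferInstance : AddCommGroup (Alg n r)), (inferInstance : Mul (Alg n r)),
    (inferInstance : One (Alg n r)) with
    mul_assoc := mul_assoc'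
    one_mul := one_mul'
    mul_one := mul_one'
    zero_mul := zero_mul'
    mul_zero := mul_zero'
    left_distrib := mul_add'
    right_distrib := add_mul' }

instance (n r : ℕ) : Algebra ℂ (Alg n r) :=
  Algebra.ofModule smul_mul' mul_smul'

/-! ### The generators `e_i`, `f_i`, `k_l` -/

theorem sum_single {n : ℕ} (p q : Fin n) :
    ∑ i, ∑ j, Matrix.single p q (1 : ℕ) i j = 1 := by
  simp [Matrix.single_apply, ite_and]

/-- The matrix `A + E_{i,q'} - E_{i',q}`. -/
def moveMat {n : ℕ} (A : Matrix (Fin n) (Fin n) ℕ) (i q' i' q : Fin n) :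
    Matrix (Fin n) (Fin n) ℕ :=
  A + Matrix.single i q' 1 - Matrix.single i' q 1

theorem moveMat_add {n : ℕ} (A : Matrix (Fin n) (Fin n) ℕ) (i q' i' q : Fin n)
    (h : 0 < A i' q) :
    moveMat A i q' i' q + Matrix.single i' q 1 = A + Matrix.single i q' 1 := by
  ext a b
  simp only [moveMat, Matrix.add_apply, Matrix.sub_apply, Matrix.single_apply]
  by_cases h2 : i' = a ∧ q = b
  · rw [if_pos h2]
    obtain ⟨rfl, rfl⟩ := h2
    omega
  · rw [if_neg h2]
    omega

/-- The matrix `A + E_{i,q'} - E_{i',q}`, if the `(i', q)` entry of `A` is positive. -/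
def move {n r : ℕ} (A : Mat n r) (i q' i' q : Fin n) (h : 0 < A.1 i' q) : Mat n r :=
  ⟨moveMat A.1 i q' i' q, by
    have h1 := moveMat_add A.1 i q' i' q h
    have h2 := congrArg (fun X : Matrix (Fin n) (Fin n) ℕ => ∑ a, ∑ b, X a b) h1
    simp only [Matrix.add_apply, Finset.sum_add_distrib, sum_single, A.2] at h2
    omega⟩

theorem diag_pos {n r : ℕ} {l : WeakComp n r} {i : Fin n} (h : 0 < l.1 i) :
    0 < (diagMat l).1 i i := by simpa [diagMat] using h

/-- `e_i = ∑_l e_{i,l}`, with `e_{i,l} = e_{diag l - E_{j,j} + E_{i,j}}` for `j = i + 1`, the sum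
being over the `l` with `l_j > 0`. -/
def eGen (n r : ℕ) (i j : Fin n) : Alg n r :=
  ∑ l : WeakComp n r, if h : 0 < l.1 j then e (move (diagMat l) i j j j (diag_pos h)) else 0

/-- `f_i = ∑_l f_{i,l}`, with `f_{i,l} = e_{diag l - E_{i,i} + E_{j,i}}` for `j = i + 1`, the sum
being over the `l` with `l_i > 0`. -/
def fGen (n r : ℕ) (i j : Fin n) : Alg n r :=
  ∑ l : WeakComp n r, if h : 0 < l.1 i then e (move (diagMat l) j i i i (diag_pos h)) else 0

theorem ne_move {n r : ℕ} (A : Mat n r) (i q' i' q : Fin n) (h : 0 < A.1 i' q) (a b : ℕ) :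
    ne (move A i q' i' q h).1 a b + (if (i' : ℕ) < a ∧ b ≤ q then 1 else 0)
      = ne A.1 a b + (if (i : ℕ) < a ∧ b ≤ q' then 1 else 0) := by
  have hs : ∀ p q : Fin n, ne (Matrix.single p q 1) a b
      = if (p : ℕ) < a ∧ b ≤ q then 1 else 0 := by
    intro p q
    unfold ne
    rw [Finset.sum_eq_single p, Finset.sum_eq_single q]
    · simp
    · intro b' _ hb; simp [hb.symm]
    · simp
    · intro a' _ ha; simp [ha.symm]
    · simp
  have hadd : ∀ X Y : Matrix (Fin n) (Fin n) ℕ, ne (X + Y) a b = ne X a b + ne Y a b := by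
    intro X Y
    simp only [ne, ← Finset.sum_add_distrib]
    refine Finset.sum_congr rfl fun a' _ => Finset.sum_congr rfl fun b' _ => ?_
    split_ifs <;> simp
  rw [← hs, ← hs, ← hadd, ← hadd]
  exact congrArg (fun X => ne X a b) (moveMat_add A.1 i q' i' q h)

theorem ro_move {n r : ℕ} (A : Mat n r) (i q' i' q : Fin n) (h : 0 < A.1 i' q) (a : Fin n) :
    (ro (move A i q' i' q h)).1 a + (if a = i' then 1 else 0)
      = (ro A).1 a + (if a = i then 1 else 0) := by
  have h1 := ne_row (move A i q' i' q h) a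
  have h2 := ne_row A a
  have h3 := ne_move A i q' i' q h a 0
  have h4 := ne_move A i q' i' q h (a + 1) 0
  simp only [Fin.ext_iff]
  split_ifs at h3 h4 ⊢ <;> omega

theorem co_move {n r : ℕ} (A : Mat n r) (i q' i' q : Fin n) (h : 0 < A.1 i' q) (b : Fin n) :
    (co (move A i q' i' q h)).1 b + (if b = q then 1 else 0)
      = (co A).1 b + (if b = q' then 1 else 0) := by
  have h1 := ne_col (move A i q' i' q h) b
  have h2 := ne_col A b
  have h3 := ne_move A i q' i' q h n b
  have h4 := ne_move A i q' i' q h n (b + 1)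
  simp only [Fin.ext_iff]
  split_ifs at h3 h4 ⊢ <;> omega

theorem co_move_same {n r : ℕ} (A : Mat n r) (i i' q : Fin n) (h : 0 < A.1 i' q) :
    co (move A i q i' q h) = co A := by
  refine Subtype.ext (funext fun b => ?_)
  have := co_move A i q i' q h b
  omega

theorem ne_diag_row {n r : ℕ} (A : Mat n r) {i j : ℕ} (hi : i ≤ n) (hij : j ≤ i) :
    ne (diagMat (ro A)).1 i j + ne A.1 j 0 = ne A.1 i 0 := by
  have h := ne_diag_lower (ro A) hij
  rwa [ne_row_congr (ro_diag (ro A)) hi, ne_row_congr (ro_diag (ro A)) (hij.trans hi)] at h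

theorem ro_pos {n r : ℕ} {A : Mat n r} {i q : Fin n} (h : 0 < A.1 i q) : 0 < (ro A).1 i :=
  lt_of_lt_of_le h (Finset.single_le_sum (f := fun q => A.1 i q) (fun _ _ => Nat.zero_le _)
    (Finset.mem_univ q))

/-- Multiplication by `e_i`: for `j = i + 1` and `p` the largest column with `A j p > 0`,
`e_i e_A = e_{A + E_{i,p} - E_{j,p}}`. -/
theorem eGen_mul {n r : ℕ} (i j : Fin n) (hij : (j : ℕ) = i + 1) (A : Mat n r) (p : Fin n)
    (hp : 0 < A.1 j p) (hmax : ∀ q, p < q → A.1 j q = 0) :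
    eGen n r i j * e A = e (move A i p j p hp) := by
  have hpos := ro_pos hp
  have hco : ∀ (l : WeakComp n r) (h : 0 < l.1 j),
      co (move (diagMat l) i j j j (diag_pos h)) = l := fun l h => by
    rw [co_move_same, co_diag]
  rw [eGen, Finset.sum_mul, Finset.sum_eq_single (ro A)]
  · rw [dif_pos hpos, e_mul_e, dif_pos (hco _ hpos)]
    congr 1
    refine prod_unique _ (fun a m b ha hm hb => ?_) (fun a b ha hb => ?_)
    · have h1 := ne_move A i p j p hp a b
      have h2 := ne_move _ i j j j (diag_pos hpos) a m
      rcases le_total a m with ham | ham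
      · have h3 := ne_monge A.1 ham hb
        rw [ne_last, ne_last] at h3
        have h4 := ne_diag_upper (ro A) ham
        by_cases hc : a = i + 1 ∧ m ≠ a
        · have h5 := ne_monge A.1 (show a + 1 ≤ m by omega) hb
          rw [ne_last, ne_last] at h5
          have h6 := rect_add_ne A.1 (Nat.le_succ a) hb
          rw [ne_last, ne_last, Nat.succ_eq_add_one] at h6
          by_cases hbp : b ≤ p
          · have h7 : rect A.1 a (a + 1) b n ≠ 0 := by
              rw [Ne, rect_eq_zero]
              intro h8
              have := h8 j p (by omega) (by omega) hbp p.2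
              omega
            split_ifs at h1 h2 <;> omega
          · split_ifs at h1 h2 <;> omega
        · split_ifs at h1 h2 <;> omega
      · have h3 := ne_monge A.1 ham (Nat.zero_le b)
        have h4 := ne_diag_row A ha ham
        split_ifs at h1 h2 <;> omega
    · have h1 := ne_move A i p j p hp a b
      by_cases hc : a = i + 1 ∧ ¬ b ≤ p
      · refine ⟨a + 1, by omega, ?_⟩
        have h2 := ne_move _ i j j j (diag_pos hpos) a (a + 1)
        have h4 := ne_diag_upper (ro A) (Nat.le_succ a)
        have h6 := rect_add_ne A.1 (Nat.le_succ a) hb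
        rw [ne_last, ne_last, Nat.succ_eq_add_one] at h6
        have h7 : rect A.1 a (a + 1) b n = 0 := by
          rw [rect_eq_zero]
          intro a' b' h8 h9 h10 _
          have : a' = j := Fin.ext (by omega)
          rw [this]
          exact hmax b' (Fin.lt_def.2 (by omega))
        simp only [Nat.succ_eq_add_one] at h4
        split_ifs at h1 h2 <;> omega
      · refine ⟨a, ha, ?_⟩
        have h2 := ne_move _ i j j j (diag_pos hpos) a a
        have h4 := ne_diag_upper (ro A) (le_refl a)
        split_ifs at h1 h2 <;> omega
  · intro l _ hl
    by_cases h : 0 < l.1 j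
    · rw [dif_pos h, e_mul_e, dif_neg (by rw [hco l h]; exact hl)]
    · rw [dif_neg h, zero_mul]
  · simp

theorem eGen_mul_zero {n r : ℕ} (i j : Fin n) (A : Mat n r) (h0 : (ro A).1 j = 0) :
    eGen n r i j * e A = 0 := by
  rw [eGen, Finset.sum_mul]
  refine Finset.sum_eq_zero fun l _ => ?_
  by_cases h : 0 < l.1 j
  · rw [dif_pos h, e_mul_e, dif_neg]
    rw [co_move_same, co_diag]
    rintro rfl
    omega
  · rw [dif_neg h, zero_mul]

/-- Multiplication by `f_i`: for `j = i + 1` and `q` the smallest column with `A i q > 0`,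
`f_i e_A = e_{A - E_{i,q} + E_{j,q}}`. -/
theorem fGen_mul {n r : ℕ} (i j : Fin n) (hij : (j : ℕ) = i + 1) (A : Mat n r) (q : Fin n)
    (hq : 0 < A.1 i q) (hmin : ∀ p, p < q → A.1 i p = 0) :
    fGen n r i j * e A = e (move A j q i q hq) := by
  have hpos := ro_pos hq
  have hco : ∀ (l : WeakComp n r) (h : 0 < l.1 i),
      co (move (diagMat l) j i i i (diag_pos h)) = l := fun l h => by
    rw [co_move_same, co_diag]
  rw [fGen, Finset.sum_mul, Finset.sum_eq_single (ro A)]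
  · rw [dif_pos hpos, e_mul_e, dif_pos (hco _ hpos)]
    congr 1
    refine prod_unique _ (fun a m b ha hm hb => ?_) (fun a b ha hb => ?_)
    · have h1 := ne_move A j q i q hq a b
      have h2 := ne_move _ j i i i (diag_pos hpos) a m
      rcases le_total a m with ham | ham
      · have h3 := ne_monge A.1 ham hb
        rw [ne_last, ne_last] at h3
        have h4 := ne_diag_upper (ro A) ham
        split_ifs at h1 h2 <;> omega
      · have h3 := ne_monge A.1 ham (Nat.zero_le b)
        have h4 := ne_diag_row A ha ham
        by_cases hc : a = i + 1 ∧ m ≠ a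
        · obtain ⟨rfl, hma⟩ := hc
          have h5 := ne_monge A.1 (show m ≤ i by omega) (Nat.zero_le b)
          have h7 := rect_add_ne A.1 (Nat.le_succ (i : ℕ)) (Nat.zero_le b)
          rw [Nat.succ_eq_add_one] at h7
          by_cases hbq : b ≤ q
          · split_ifs at h1 h2 <;> omega
          · have h8 : rect A.1 i (i + 1) 0 b ≠ 0 := by
              rw [Ne, rect_eq_zero]
              intro h8
              have := h8 i q (by omega) (by omega) (by omega) (by omega)
              omega
            split_ifs at h1 h2 <;> omega
        · split_ifs at h1 h2 <;> omega
    · have h1 := ne_move A j q i q hq a b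
      by_cases hc : a = i + 1 ∧ b ≤ q
      · obtain ⟨rfl, hbq⟩ := hc
        refine ⟨i, by omega, ?_⟩
        have h2 := ne_move _ j i i i (diag_pos hpos) (i + 1) i
        have h4 := ne_diag_row A ha (Nat.le_succ (i : ℕ))
        have h7 := rect_add_ne A.1 (Nat.le_succ (i : ℕ)) (Nat.zero_le b)
        rw [Nat.succ_eq_add_one] at h7
        have h8 : rect A.1 i (i + 1) 0 b = 0 := by
          rw [rect_eq_zero]
          intro a' b' h8 h9 _ h10
          have : a' = i := Fin.ext (by omega)
          rw [this]
          exact hmin b' (Fin.lt_def.2 (by omega))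
        split_ifs at h1 h2 <;> omega
      · refine ⟨a, ha, ?_⟩
        have h2 := ne_move _ j i i i (diag_pos hpos) a a
        have h4 := ne_diag_upper (ro A) (le_refl a)
        split_ifs at h1 h2 <;> omega
  · intro l _ hl
    by_cases h : 0 < l.1 i
    · rw [dif_pos h, e_mul_e, dif_neg (by rw [hco l h]; exact hl)]
    · rw [dif_neg h, zero_mul]
  · simp

theorem fGen_mul_zero {n r : ℕ} (i j : Fin n) (A : Mat n r) (h0 : (ro A).1 i = 0) :
    fGen n r i j * e A = 0 := by
  rw [fGen, Finset.sum_mul]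
  refine Finset.sum_eq_zero fun l _ => ?_
  by_cases h : 0 < l.1 i
  · rw [dif_pos h, e_mul_e, dif_neg]
    rw [co_move_same, co_diag]
    rintro rfl
    omega
  · rw [dif_neg h, zero_mul]


theorem move_entry {n r : ℕ} (A : Mat n r) (i q' i' q : Fin n) (h : 0 < A.1 i' q) (a b : Fin n) :
    (move A i q' i' q h).1 a b + (if i' = a ∧ q = b then 1 else 0)
      = A.1 a b + (if i = a ∧ q' = b then 1 else 0) :=
  congrFun (congrFun (moveMat_add A.1 i q' i' q h) a) b

/-- Moving a unit back and forth. -/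
theorem move_move {n r : ℕ} (A : Mat n r) (i q' i' q : Fin n) (h : 0 < A.1 i' q)
    (h' : 0 < (move A i q' i' q h).1 i q') : move (move A i q' i' q h) i' q i q' h' = A := by
  refine Subtype.ext (Matrix.ext fun a b => ?_)
  have h1 := move_entry A i q' i' q h a b
  have h2 := move_entry _ i' q i q' h' a b
  split_ifs at h1 h2 <;> omega

/-- The algebra is generated by the elements `e_i`, `f_i` and `k_l`. -/
theorem adjoin_generators (n r : ℕ) :
    Algebra.adjoin ℂ ({x : Alg n r | (∃ l, x = k l) ∨ ∃ i j : Fin n, (j : ℕ) = i + 1 ∧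
      (x = eGen n r i j ∨ x = fGen n r i j)}) = ⊤ := by
  set G := Algebra.adjoin ℂ ({x : Alg n r | (∃ l, x = k l) ∨ ∃ i j : Fin n, (j : ℕ) = i + 1 ∧
      (x = eGen n r i j ∨ x = fGen n r i j)}) with hG
  have hk : ∀ l, k l ∈ G := fun l => Algebra.subset_adjoin (Or.inl ⟨l, rfl⟩)
  have he : ∀ i j : Fin n, (j : ℕ) = i + 1 → eGen n r i j ∈ G := fun i j h =>
    Algebra.subset_adjoin (Or.inr ⟨i, j, h, Or.inl rfl⟩)
  have hf : ∀ i j : Fin n, (j : ℕ) = i + 1 → fGen n r i j ∈ G := fun i j h =>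
    Algebra.subset_adjoin (Or.inr ⟨i, j, h, Or.inr rfl⟩)
  -- the distance from being a diagonal matrix
  let wt : Mat n r → ℕ := fun A => ∑ a : Fin n, ∑ b : Fin n,
    A.1 a b * ((a : ℕ) - b + ((b : ℕ) - a))
  have hwt : ∀ (A : Mat n r) (i i' q : Fin n) (h : 0 < A.1 i' q),
      wt (move A i q i' q h) + ((i' : ℕ) - q + ((q : ℕ) - i'))
        = wt A + ((i : ℕ) - q + ((q : ℕ) - i)) := by
    intro A i i' q h
    have hs : ∀ p q : Fin n, ∑ a : Fin n, ∑ b : Fin n,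
        (if p = a ∧ q = b then 1 else 0) * ((a : ℕ) - b + ((b : ℕ) - a))
          = (p : ℕ) - q + ((q : ℕ) - p) := by
      intro p q
      simp [ite_and]
    rw [← hs, ← hs]
    simp only [wt, ← Finset.sum_add_distrib, ← add_mul, move_entry A i q i' q h]
  have main : ∀ (w : ℕ) (A : Mat n r), wt A = w → e A ∈ G := by
    intro w
    induction w using Nat.strong_induction_on with
    | _ w ih =>
      intro A hA
      by_cases hlow : ∃ q : Fin n, ∃ a : Fin n, q < a ∧ 0 < A.1 a q
      · -- the first column with an entry below the diagonal
        obtain ⟨q, hq, hmin⟩ := WellFounded.has_min (wellFounded_lt (α := Fin n))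
          {q | ∃ a : Fin n, q < a ∧ 0 < A.1 a q} hlow
        obtain ⟨a, hqa, ha⟩ := hq
        rw [Fin.lt_def] at hqa
        let i : Fin n := ⟨a - 1, by omega⟩
        have hia : (a : ℕ) = i + 1 := by simp only [i]; omega
        have hpos : 0 < (move A i q a q ha).1 i q := by
          have := move_entry A i q a q ha i q
          have hne : ¬ (a = i ∧ q = q) := fun h => by
            have := congrArg Fin.val h.1; omega
          rw [if_neg hne, if_pos ⟨rfl, rfl⟩] at this
          omega
        have h1 := fGen_mul i a hia (move A i q a q ha) q hpos (fun p hp => by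
          have := move_entry A i q a q ha i p
          have hne : ¬ (i = i ∧ q = p) := fun h => absurd h.2 hp.ne'
          rw [if_neg hne] at this
          have h0 : A.1 i p = 0 := by
            by_contra hcon
            refine hmin p ⟨i, ?_, Nat.pos_of_ne_zero hcon⟩ hp
            rw [Fin.lt_def] at hp ⊢; omega
          omega)
        rw [move_move] at h1
        rw [← h1]
        refine mul_mem (hf i a hia) (ih _ ?_ _ rfl)
        have := hwt A i a q ha
        omega
      by_cases hup : ∃ q : Fin n, ∃ a : Fin n, a < q ∧ 0 < A.1 a q
      · -- the last column with an entry above the diagonal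
        obtain ⟨q, hq, hmax⟩ := WellFounded.has_min (wellFounded_gt (α := Fin n))
          {q | ∃ a : Fin n, a < q ∧ 0 < A.1 a q} hup
        obtain ⟨a, hqa, ha⟩ := hq
        rw [Fin.lt_def] at hqa
        let i : Fin n := ⟨a + 1, by omega⟩
        have hia : (i : ℕ) = a + 1 := rfl
        have hpos : 0 < (move A i q a q ha).1 i q := by
          have := move_entry A i q a q ha i q
          have hne : ¬ (a = i ∧ q = q) := fun h => by
            have := congrArg Fin.val h.1; omega
          rw [if_neg hne, if_pos ⟨rfl, rfl⟩] at this
          omega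
        have h1 := eGen_mul a i hia (move A i q a q ha) q hpos (fun p hp => by
          have := move_entry A i q a q ha i p
          have hne : ¬ (i = i ∧ q = p) := fun h => absurd h.2 hp.ne
          rw [if_neg hne] at this
          have h0 : A.1 i p = 0 := by
            by_contra hcon
            refine hmax p ⟨i, ?_, Nat.pos_of_ne_zero hcon⟩ hp
            rw [Fin.lt_def] at hp ⊢; omega
          omega)
        rw [move_move] at h1
        rw [← h1]
        refine mul_mem (he a i hia) (ih _ ?_ _ rfl)
        have := hwt A i a q ha
        omega
      · have : A = diagMat (ro A) := by
          refine Subtype.ext (Matrix.ext fun a b => ?_)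
          push Not at hlow hup
          by_cases hab : a = b
          · subst hab
            simp only [diagMat, Matrix.diagonal_apply_eq, ro]
            refine (Finset.sum_eq_single a (fun b _ hb => ?_) (by simp)).symm
            rcases lt_or_gt_of_ne hb with h | h
            · have := hlow b a h; omega
            · have := hup b a h; omega
          · simp only [diagMat, Matrix.diagonal_apply_ne _ hab]
            rcases lt_or_gt_of_ne hab with h | h
            · have := hup b a h; omega
            · have := hlow b a h; omega
        rw [this]
        exact hk _
  refine eq_top_iff.2 fun x _ => ?_
  refine alg_induction (p := fun x => x ∈ G) x G.zero_mem (fun _ _ => G.add_mem) ?_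
  intro c A
  exact G.smul_mem (main _ A rfl) c

/-! ### The projective module `P_l` -/

/-- Every `2 × 2` submatrix has at least one zero on its diagonal. -/
def IsOpenMat {n : ℕ} (M : Matrix (Fin n) (Fin n) ℕ) : Prop :=
  ∀ i i' j j' : Fin n, i < i' → j < j' → M i j = 0 ∨ M i' j' = 0

/-- The matrix `A(α; v)`: the columns of `A` in the `v`-th block of `α` are kept, the others are
replaced by zero. -/
def colBlock {n : ℕ} (c : Composition n) (v : Fin c.length) (A : Matrix (Fin n) (Fin n) ℕ) :
    Matrix (Fin n) (Fin n) ℕ :=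
  fun i j => if c.index j = v then A i j else 0

/-- `A` is open on columns with respect to the strong composition `c` of `n`. -/
def OpenOnColumns {n : ℕ} (c : Composition n) (A : Matrix (Fin n) (Fin n) ℕ) : Prop :=
  ∀ v : Fin c.length, IsOpenMat (colBlock c v A)

/-- The first position of the `v`-th block of `c`. -/
def firstPos {n : ℕ} (c : Composition n) (v : Fin c.length) : Fin n :=
  c.embedding v ⟨0, c.blocks_pos' v v.2⟩

/-- The last position of the `v`-th block of `c`. -/
def lastPos {n : ℕ} (c : Composition n) (v : Fin c.length) : Fin n :=
  c.embedding v ⟨c.blocksFun v - 1, Nat.sub_lt (c.blocks_pos' v v.2) Nat.one_pos⟩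

/-- `c` is maximal with respect to `l`: each block of `l` cut out by `c` is either `(0)` or has
neither its first nor its last entry equal to zero. -/
def IsMaximalFor {n r : ℕ} (c : Composition n) (l : WeakComp n r) : Prop :=
  ∀ v : Fin c.length, (c.blocksFun v = 1 ∧ l.1 (firstPos c v) = 0) ∨
    (l.1 (firstPos c v) ≠ 0 ∧ l.1 (lastPos c v) ≠ 0)

/-- The index set of `B^l`: the matrices `A` with `co A = l` that are not open on columns with
respect to any `α ≠ (1, …, 1)` that is maximal with respect to `l`. -/
def BSet {n r : ℕ} (l : WeakComp n r) : Set (Mat n r) :=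
  {A | co A = l ∧ ∀ c : Composition n, IsMaximalFor c l → c ≠ Composition.ones n →
    ¬ OpenOnColumns c A.1}

/-- The index set of `β^l`: the column block diagonal matrices, that is, those such that
`A i j > 0` forces `A i' j' = 0` for `i' ≤ i`, `j' > j`, with column sums `l`. -/
def cbSet {n r : ℕ} (l : WeakComp n r) : Set (Mat n r) :=
  {A | co A = l ∧ ∀ i j : Fin n, 0 < A.1 i j → ∀ i' j' : Fin n, i' ≤ i → j < j' → A.1 i' j' = 0}

theorem openOnColumns_iff {n : ℕ} (c : Composition n) (A : Matrix (Fin n) (Fin n) ℕ) :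
    OpenOnColumns c A ↔ ∀ v : Fin c.length, ∀ i k, i ≤ n → c.sizeUpTo v ≤ k →
      k ≤ c.sizeUpTo (v + 1) →
      ne A i k = ne A i (c.sizeUpTo v) ∨
      ne A i k + ne A n (c.sizeUpTo (v + 1)) = ne A i (c.sizeUpTo (v + 1)) + ne A n k := by
  have key : ∀ (v : Fin c.length) (j : Fin n), c.index j = v ↔
      c.sizeUpTo v ≤ j ∧ (j : ℕ) < c.sizeUpTo (v + 1) := fun v j => by
    rw [eq_comm, ← c.mem_range_embedding_iff', c.mem_range_embedding_iff]
  refine forall_congr' fun v => ?_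
  have e1 : ∀ i k, i ≤ n → c.sizeUpTo v ≤ k →
      (ne A i k = ne A i (c.sizeUpTo v) ↔ rect A 0 i (c.sizeUpTo v) k = 0) := by
    intro i k _ hk
    have := rect_add_ne A (Nat.zero_le i) hk
    rw [ne_zero_left, ne_zero_left] at this
    omega
  have e2 : ∀ i k, i ≤ n → k ≤ c.sizeUpTo (v + 1) →
      (ne A i k + ne A n (c.sizeUpTo (v + 1)) = ne A i (c.sizeUpTo (v + 1)) + ne A n k ↔
        rect A i n k (c.sizeUpTo (v + 1)) = 0) := by
    intro i k hi hk
    have := rect_add_ne A hi hk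
    omega
  constructor
  · intro h i k hi hk hk'
    rw [e1 i k hi hk, e2 i k hi hk', rect_eq_zero, rect_eq_zero]
    by_contra hcon
    push Not at hcon
    obtain ⟨⟨a, b, _, h2, h3, h4, h5⟩, a', b', h6, _, h8, h9, h10⟩ := hcon
    have hb : c.index b = v := (key v b).2 ⟨h3, by omega⟩
    have hb' : c.index b' = v := (key v b').2 ⟨by omega, h9⟩
    have := h a a' b b' (Fin.lt_def.2 (by omega)) (Fin.lt_def.2 (by omega))
    simp only [colBlock, if_pos hb, if_pos hb'] at this
    tauto
  · intro h i i' j j' hi hj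
    by_cases hb : c.index j = v
    · by_cases hb' : c.index j' = v
      · simp only [colBlock, if_pos hb, if_pos hb']
        have h1 := (key v j).1 hb
        have h2 := (key v j').1 hb'
        rw [Fin.lt_def] at hi hj
        have := h (i + 1) (j + 1) i.2 (by omega) (by omega)
        rw [e1 _ _ i.2 (by omega), e2 _ _ i.2 (by omega), rect_eq_zero, rect_eq_zero] at this
        rcases this with h3 | h3
        · exact Or.inl (h3 i j (by omega) (by omega) (by omega) (by omega))
        · exact Or.inr (h3 i' j' (by omega) (by omega) (by omega) (by omega))
      · right; simp only [colBlock, if_neg hb']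
    · left; simp only [colBlock, if_neg hb]

theorem OpenOnColumns.prod {n r : ℕ} {C A : Mat n r} (h : co C = ro A) {c : Composition n}
    (hA : OpenOnColumns c A.1) : OpenOnColumns c (prod C A h).1 := by
  rw [openOnColumns_iff] at hA ⊢
  intro v i k hi hk hk'
  have hw : c.sizeUpTo (v + 1) ≤ n := c.sizeUpTo_le _
  have hu : c.sizeUpTo v ≤ n := c.sizeUpTo_le _
  have hkn : k ≤ n := hk'.trans hw
  obtain ⟨j, hj, h1⟩ := ne_prod_exists h hi hkn
  rw [ne_prod_col h hw, ne_prod_col h hkn]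
  rcases hA v j k hj hk hk' with h2 | h2
  · left
    have h3 := ne_prod_le h hi hj hu
    have h4 := ne_monge (SchurZero.prod C A h).1 (Nat.zero_le i) hk
    rw [ne_zero_left, ne_zero_left] at h4
    omega
  · right
    have h3 := ne_prod_le h hi hj hw
    have h4 := ne_monge (SchurZero.prod C A h).1 hi hk'
    rw [ne_prod_col h hw, ne_prod_col h hkn] at h4
    omega

/-- The complement of `B^l` is stable under left multiplication. -/
theorem prod_notMem_BSet {n r : ℕ} {l : WeakComp n r} {C A : Mat n r} (h : co C = ro A)
    (hA : A ∉ BSet l) : prod C A h ∉ BSet l := by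
  intro hB
  refine hA ⟨by rw [← hB.1, co_prod], fun c hc hc' ho => ?_⟩
  exact hB.2 c hc hc' (ho.prod h)

theorem cb_iff {n r : ℕ} (A : Mat n r) :
    (∀ i j : Fin n, 0 < A.1 i j → ∀ i' j' : Fin n, i' ≤ i → j < j' → A.1 i' j' = 0) ↔
    ∀ j, j ≤ n → ∃ i, i ≤ n ∧ ne A.1 i j = 0 ∧ ne A.1 n j + ne A.1 i 0 = r := by
  have e1 : ∀ i j, j ≤ n → (ne A.1 i j = 0 ↔ rect A.1 0 i j n = 0) := by
    intro i j hj
    have := rect_add_ne A.1 (Nat.zero_le i) hj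
    rw [ne_zero_left, ne_zero_left, ne_last] at this
    omega
  have e2 : ∀ i j, i ≤ n → ne A.1 i j = 0 →
      (ne A.1 n j + ne A.1 i 0 = r ↔ rect A.1 i n 0 j = 0) := by
    intro i j hi h0
    have := rect_add_ne A.1 hi (Nat.zero_le j)
    rw [ne_full'] at this
    omega
  constructor
  · intro h j hj
    obtain ⟨i, hi, h0, hmax⟩ : ∃ i, i ≤ n ∧ ne A.1 i j = 0 ∧
        ∀ i', i < i' → i' ≤ n → ne A.1 i' j ≠ 0 :=
      ⟨Nat.findGreatest (fun i => ne A.1 i j = 0) n, Nat.findGreatest_le n,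
        Nat.findGreatest_spec (P := fun i => ne A.1 i j = 0) (Nat.zero_le n) (ne_zero_left _ _),
        fun i' h1 h2 =>
          Nat.findGreatest_is_greatest (P := fun i => ne A.1 i j = 0) h1 h2⟩
    refine ⟨i, hi, h0, ?_⟩
    rw [e2 i j hi h0, rect_eq_zero]
    intro a b h1 h2 _ h4
    have h5 := hmax (i + 1) (by omega) (by omega)
    rw [Ne, e1 _ _ hj, rect_eq_zero] at h5
    push Not at h5
    obtain ⟨a', b', _, h7, h8, _, h10⟩ := h5
    by_contra hab
    exact h10 (h a b (Nat.pos_of_ne_zero hab) a' b' (Fin.le_def.2 (by omega))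
      (Fin.lt_def.2 (by omega)))
  · intro h i j hij i' j' hi hj
    obtain ⟨m, hm, h1, h2⟩ := h (j + 1) j.2
    rw [e2 _ _ hm h1, rect_eq_zero] at h2
    rw [e1 _ _ j.2, rect_eq_zero] at h1
    rw [Fin.le_def] at hi
    rw [Fin.lt_def] at hj
    by_cases him : (i : ℕ) < m
    · exact h1 i' j' (by omega) (by omega) (by omega) (by omega)
    · have := h2 i j (by omega) (by omega) (by omega) (by omega)
      omega

/-- The complement of `β^l` is stable under left multiplication. -/
theorem prod_notMem_cbSet {n r : ℕ} {l : WeakComp n r} {C A : Mat n r} (h : co C = ro A)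
    (hA : A ∉ cbSet l) : prod C A h ∉ cbSet l := by
  intro hB
  refine hA ⟨by rw [← hB.1, co_prod], ?_⟩
  have h2 := hB.2
  rw [cb_iff] at h2 ⊢
  intro j hj
  obtain ⟨i, hi, h3, h4⟩ := h2 j hj
  rw [ne_prod_col h hj, ne_prod_row h hi] at h4
  obtain ⟨m, hm, h5⟩ := ne_prod_exists h hi hj
  have h6 := ne_compl h hm
  have h7 := ne_monge C.1 hi (Nat.zero_le m)
  have h8 := ne_monge A.1 hm (Nat.zero_le j)
  rw [ne_full'] at h7 h8
  exact ⟨m, hm, by omega, by omega⟩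

/-- The `ℂ`-span of `B^l`, with basis indexed by `BSet l`. -/
def P {n r : ℕ} (l : WeakComp n r) : Type := BSet l →₀ ℂ

instance {n r : ℕ} (l : WeakComp n r) : AddCommGroup (P l) :=
  inferInstanceAs (AddCommGroup (BSet l →₀ ℂ))

instance {n r : ℕ} (l : WeakComp n r) : Module ℂ (P l) :=
  inferInstanceAs (Module ℂ (BSet l →₀ ℂ))

/-- The basis element of `P_l` given by `A ∈ B^l`. -/
def eP {n r : ℕ} {l : WeakComp n r} (A : BSet l) : P l := Finsupp.single A 1

/-- The inclusion of the span of `B^l` in the algebra, `e_A ↦ e_A`. -/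
def incl {n r : ℕ} (l : WeakComp n r) : P l →ₗ[ℂ] Alg n r :=
  (Finsupp.lmapDomain ℂ ℂ Subtype.val : (BSet l →₀ ℂ) →ₗ[ℂ] (Mat n r →₀ ℂ))

/-- The projection of the algebra to the span of `B^l`: `e_A ↦ e_A` if `e_A ∈ B^l`, and
`e_A ↦ 0` otherwise. -/
def proj {n r : ℕ} (l : WeakComp n r) : Alg n r →ₗ[ℂ] P l :=
  (Finsupp.lsubtypeDomain (BSet l) : (Mat n r →₀ ℂ) →ₗ[ℂ] (BSet l →₀ ℂ))

theorem incl_eP {n r : ℕ} {l : WeakComp n r} (A : BSet l) : incl l (eP A) = e A.1 :=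
  Finsupp.mapDomain_single

theorem proj_e_mem {n r : ℕ} {l : WeakComp n r} {A : Mat n r} (hA : A ∈ BSet l) :
    proj l (e A) = eP ⟨A, hA⟩ := by
  classical
  refine Finsupp.ext fun B => ?_
  change (Finsupp.single A (1 : ℂ) : Mat n r →₀ ℂ) B.1 =
    (Finsupp.single ⟨A, hA⟩ (1 : ℂ) : BSet l →₀ ℂ) B
  rw [Finsupp.single_apply, Finsupp.single_apply]
  simp only [Subtype.ext_iff]

theorem proj_e_notMem {n r : ℕ} {l : WeakComp n r} {A : Mat n r} (hA : A ∉ BSet l) :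
    proj l (e A) = 0 := by
  refine Finsupp.ext fun B => ?_
  change (Finsupp.single A (1 : ℂ) : Mat n r →₀ ℂ) B.1 = 0
  exact Finsupp.single_eq_of_ne (fun h => hA (h ▸ B.2))

theorem P_induction {n r : ℕ} {l : WeakComp n r} {p : P l → Prop} (x : P l) (h0 : p 0)
    (hadd : ∀ x y, p x → p y → p (x + y)) (hs : ∀ (c : ℂ) (A : BSet l), p (c • eP A)) : p x := by
  refine Finsupp.induction_linear (motive := p) x h0 hadd fun A c => ?_
  have : (Finsupp.single A c : BSet l →₀ ℂ) = c • Finsupp.single A 1 := by simp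
  rw [this]
  exact hs c A

theorem proj_incl {n r : ℕ} {l : WeakComp n r} (x : P l) : proj l (incl l x) = x := by
  refine P_induction (p := fun x => proj l (incl l x) = x) x (by simp) ?_ ?_
  · intro x y hx hy; simp only [map_add, hx, hy]
  · intro c A; simp only [map_smul, incl_eP, proj_e_mem A.2]

/-- The kernel of the projection is a left ideal. -/
theorem proj_mul {n r : ℕ} {l : WeakComp n r} (a x : Alg n r) :
    proj l (a * incl l (proj l x)) = proj l (a * x) := by
  refine alg_induction (p := fun x => proj l (a * incl l (proj l x)) = proj l (a * x)) x
    (by simp) ?_ ?_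
  · intro x y hx hy; simp only [map_add, mul_add, hx, hy]
  intro c A
  by_cases hA : A ∈ BSet l
  · simp only [map_smul, proj_e_mem hA, incl_eP]
  refine alg_induction
    (p := fun a => proj l (a * incl l (proj l (c • e A))) = proj l (a * (c • e A))) a
    (by simp) ?_ ?_
  · intro x y hx hy; simp only [map_add, add_mul, hx, hy]
  intro d C
  simp only [map_smul, proj_e_notMem hA, smul_zero, map_zero, mul_zero, smul_mul_assoc,
    mul_smul_comm, e_mul_e]
  split_ifs with h
  · rw [proj_e_notMem (prod_notMem_BSet h hA)]; simp
  · simp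

/-- The action on `P_l`: on basis elements, `e_C · e_A = e_B` if `e_C e_A = e_B` in the algebra
and `e_B ∈ B^l`, and `e_C · e_A = 0` otherwise (see `e_smul_eP`). -/
instance {n r : ℕ} (l : WeakComp n r) : Module (Alg n r) (P l) where
  smul a x := proj l (a * incl l x)
  one_smul x := by
    change proj l (1 * incl l x) = x
    rw [one_mul, proj_incl]
  mul_smul a b x := by
    change proj l (a * b * incl l x) = proj l (a * incl l (proj l (b * incl l x)))
    rw [proj_mul, mul_assoc]
  smul_zero a := by
    change proj l (a * incl l 0) = 0
    simp
  smul_add a x y := by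
    change proj l (a * incl l (x + y)) = proj l (a * incl l x) + proj l (a * incl l y)
    simp only [map_add, mul_add]
  add_smul a b x := by
    change proj l ((a + b) * incl l x) = proj l (a * incl l x) + proj l (b * incl l x)
    simp only [map_add, add_mul]
  zero_smul x := by
    change proj l (0 * incl l x) = 0
    simp

theorem smul_def {n r : ℕ} {l : WeakComp n r} (a : Alg n r) (x : P l) :
    a • x = proj l (a * incl l x) := rfl

open Classical in
theorem e_smul_eP {n r : ℕ} {l : WeakComp n r} (C : Mat n r) (A : BSet l) :
    e C • eP A = if h : ∃ h : co C = ro A.1, prod C A.1 h ∈ BSet l then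
      eP ⟨prod C A.1 h.1, h.2⟩ else 0 := by
  rw [smul_def, incl_eP, e_mul_e]
  by_cases h : co C = ro A.1
  · rw [dif_pos h]
    by_cases h' : prod C A.1 h ∈ BSet l
    · rw [dif_pos ⟨h, h'⟩, proj_e_mem h']
    · rw [dif_neg (fun hh => h' hh.2), proj_e_notMem h']
  · rw [dif_neg h, dif_neg (fun hh => h hh.1), map_zero]

instance {n r : ℕ} (l : WeakComp n r) : IsScalarTower ℂ (Alg n r) (P l) where
  smul_assoc c a x := by
    rw [smul_def, smul_def, smul_mul_assoc, map_smul]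

/-! ### The submodule `N_l`, the quotient `S_l`, and tops -/

/-- The submodule `N_l` of `P_l`: the `ℂ`-span of `B^l \ β^l`. -/
def N {n r : ℕ} (l : WeakComp n r) : Submodule (Alg n r) (P l) where
  __ := (Submodule.span ℂ {x : P l | ∃ A : BSet l, A.1 ∉ cbSet l ∧ x = eP A}).toAddSubmonoid
  smul_mem' a x hx := by
    change a • x ∈ Submodule.span ℂ {x : P l | ∃ A : BSet l, A.1 ∉ cbSet l ∧ x = eP A}
    change x ∈ Submodule.span ℂ {x : P l | ∃ A : BSet l, A.1 ∉ cbSet l ∧ x = eP A} at hx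
    induction hx using Submodule.span_induction with
    | zero => rw [smul_zero]; exact Submodule.zero_mem _
    | add x y _ _ hx hy => rw [smul_add]; exact Submodule.add_mem _ hx hy
    | smul c x _ hx =>
      rw [smul_def, map_smul, mul_smul_comm, map_smul, ← smul_def]
      exact Submodule.smul_mem _ c hx
    | mem x hx =>
      obtain ⟨A, hA, rfl⟩ := hx
      refine alg_induction (p := fun a => a • eP A ∈
        Submodule.span ℂ {x : P l | ∃ A : BSet l, A.1 ∉ cbSet l ∧ x = eP A}) a ?_ ?_ ?_
      · rw [zero_smul]; exact Submodule.zero_mem _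
      · intro a b ha hb; rw [add_smul]; exact Submodule.add_mem _ ha hb
      · intro c C
        rw [smul_assoc, e_smul_eP]
        refine Submodule.smul_mem _ c ?_
        split_ifs with h
        · exact Submodule.subset_span ⟨_, prod_notMem_cbSet h.1 hA, rfl⟩
        · exact Submodule.zero_mem _

theorem coe_N {n r : ℕ} (l : WeakComp n r) : (N l : Set (P l)) =
    Submodule.span ℂ {x : P l | ∃ A : BSet l, A.1 ∉ cbSet l ∧ x = eP A} := rfl

/-- `S_l = P_l / N_l`. -/
abbrev S {n r : ℕ} (l : WeakComp n r) : Type := P l ⧸ N l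

/-- The top of a module: its quotient by its radical, the intersection of its maximal
submodules. -/
abbrev top (R M : Type*) [Ring R] [AddCommGroup M] [Module R M] : Type _ :=
  M ⧸ Module.jacobson R M

end

end SchurZero

namespace SchurZero

/-!
Order the matrices by their corner sums. Column block diagonal matrices are the least ones with
given row and column sums, and the generic product is monotone for this order. Hence if both the
row and the column sums of `C` are `l = co A`, then `A = A · diag l ≤ A · C`. If `A ∈ B^l` and `C`
is not diagonal the inequality is strict: `A · C = A` would make `A` open on a block of columns
that starts and ends at two consecutive nonzero entries of `l`. So, starting from an element
`k_l - y` with `y ∈ N_l`, a descending induction shows that it generates `P_l`, that is, `N_l` is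
superfluous. It is also maximal: for `A ∈ β^l`, left multiplication by the transpose of `A`
is, modulo `N_l`, the `A`-coordinate times `k_l`.
-/

variable {n r : ℕ} {l : WeakComp n r}

theorem ne_le_ne (A : Matrix (Fin n) (Fin n) ℕ) {i i' k k' : ℕ} (hi : i ≤ i') (hk : k ≤ k') :
    ne A i k' ≤ ne A i' k := by
  refine Finset.sum_le_sum fun a _ => Finset.sum_le_sum fun b _ => ?_
  split_ifs <;> omega

theorem exists_ne_zero_of_ne_pos {A : Matrix (Fin n) (Fin n) ℕ} {i k : ℕ} (h : 0 < ne A i k) :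
    ∃ a b : Fin n, (a : ℕ) < i ∧ k ≤ (b : ℕ) ∧ A a b ≠ 0 := by
  obtain ⟨a, -, ha⟩ := Finset.exists_ne_zero_of_sum_ne_zero h.ne'
  obtain ⟨b, -, hb⟩ := Finset.exists_ne_zero_of_sum_ne_zero ha
  obtain ⟨⟨hai, hkb⟩, hab⟩ := ite_ne_right_iff.1 hb
  exact ⟨a, b, hai, hkb, hab⟩

theorem co_ne_zero_iff {A : Mat n r} {b : Fin n} : (co A).1 b ≠ 0 ↔ ∃ a, A.1 a b ≠ 0 := by
  simp [co, Finset.sum_eq_zero_iff]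

theorem ne_succ_le (A : Mat n r) (a : Fin n) (k : ℕ) :
    ne A.1 (a + 1) k ≤ ne A.1 a k + (ro A).1 a := by
  have hmonge := ne_monge A.1 (Nat.le_succ a) (Nat.zero_le k)
  have hrow := ne_row A a
  simp only [Nat.succ_eq_add_one] at hmonge
  omega

theorem ne_eq_ne_of_co_eq_zero {A : Mat n r} {k k' : ℕ} (hk : k ≤ k')
    (h : ∀ b : Fin n, k ≤ (b : ℕ) → (b : ℕ) < k' → (co A).1 b = 0) (i : ℕ) :
    ne A.1 i k = ne A.1 i k' := by
  have hrect : rect A.1 0 i k k' = 0 := by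
    refine rect_eq_zero A.1 |>.2 fun a b _ _ hkb hbk' => ?_
    by_contra hab
    exact co_ne_zero_iff.2 ⟨a, hab⟩ (h b hkb hbk')
  have hadd := rect_add_ne A.1 (Nat.zero_le i) hk
  simp only [ne_zero_left] at hadd
  omega

/-! ### The degeneration order -/

/-- The degeneration order on relative positions of pairs of flags: `A ≤ B` if every corner sum of
`A` is at most the corresponding corner sum of `B`. Larger matrices are more generic. -/
instance : PartialOrder (Mat n r) where
  le A B := ∀ i k, i ≤ n → k ≤ n → ne A.1 i k ≤ ne B.1 i k
  le_refl _ _ _ _ _ := le_rfl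
  le_trans _ _ _ hAB hBC i k hi hk := (hAB i k hi hk).trans (hBC i k hi hk)
  le_antisymm _ _ hAB hBA :=
    Subtype.ext (ne_inj fun i k hi hk => (hAB i k hi hk).antisymm (hBA i k hi hk))

instance : Finite (Mat n r) := by
  refine Set.Finite.subset (Set.finite_Iic (fun _ _ => r : Fin n → Fin n → ℕ))
    fun A (hA : ∑ i, ∑ j, A i j = r) i j => ?_
  calc A i j ≤ ∑ j, A i j := Finset.single_le_sum_of_canonicallyOrdered (Finset.mem_univ j)
    _ ≤ ∑ i, ∑ j, A i j :=
      Finset.single_le_sum_of_canonicallyOrdered (f := fun i => ∑ j, A i j) (Finset.mem_univ i)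
    _ = r := hA

theorem prod_mono_right {A B C : Mat n r} (hB : co A = ro B) (hC : co A = ro C) (h : B ≤ C) :
    prod A B hB ≤ prod A C hC := by
  intro i k hi hk
  obtain ⟨j, hj, hprod⟩ := ne_prod_exists hC hi hk
  rw [hprod]
  exact (ne_prod_le hB hi hj hk).trans (Nat.add_le_add_left (h j k hj hk) _)

theorem le_of_mem_cbSet {A B : Mat n r} (hA : A ∈ cbSet l) (hro : ro A = ro B) (hco : co B = l) :
    A ≤ B := by
  intro i k hi hk
  -- Every corner sum of `A` is the least one its row and column sums allow.
  obtain ⟨m, -, hnorth, hsouth⟩ := (cb_iff A).1 hA.2 k hk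
  rcases le_total i m with him | hmi
  · have := ne_le_ne A.1 him (le_refl k)
    omega
  · have hcolA := ne_compl (hA.1.trans (ro_diag l).symm) hk
    have hcolB := ne_compl (hco.trans (ro_diag l).symm) hk
    have hrow := ne_row_congr hro hi
    have hmongeA := ne_monge A.1 hmi (Nat.zero_le k)
    have hmongeB := ne_monge B.1 hi (Nat.zero_le k)
    rw [ne_full'] at hmongeB
    omega

theorem eq_of_mem_cbSet {A B : Mat n r} (hA : A ∈ cbSet l) (hB : B ∈ cbSet l)
    (hro : ro A = ro B) : A = B :=
  (le_of_mem_cbSet hA hro hB.1).antisymm (le_of_mem_cbSet hB hro.symm hA.1)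

theorem mem_cbSet_of_ne_self_eq_zero {C : Mat n r} (hro : ro C = l) (hco : co C = l)
    (h : ∀ j, j ≤ n → ne C.1 j j = 0) : C ∈ cbSet l :=
  ⟨hco, (cb_iff C).2 fun j hj => ⟨j, hj, h j hj, ne_compl (hco.trans hro.symm) hj⟩⟩

theorem diagMat_mem_cbSet (l : WeakComp n r) : diagMat l ∈ cbSet l :=
  mem_cbSet_of_ne_self_eq_zero (ro_diag l) (co_diag l) fun _ _ => ne_diag_upper l le_rfl

theorem le_prod_of_ro_eq_co {A C : Mat n r} (h : co A = ro C) (hC : ro C = co C) :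
    A ≤ prod A C h := by
  have hdiag : co A = ro (diagMat (co C)) := by rw [ro_diag, h, hC]
  calc A = prod A (diagMat (co C)) hdiag := (prod_diag_right hdiag).symm
    _ ≤ prod A C h :=
      prod_mono_right _ _ (le_of_mem_cbSet (diagMat_mem_cbSet _) (hdiag.symm.trans h) rfl)

/-- The composition `(1, …, 1, q - p + 1, 1, …, 1)` of `n` whose `p`-th block is
`{p, p + 1, …, q}`, all other blocks being singletons. -/
def blockComp (p q : Fin n) (hpq : p ≤ q) : Composition n where
  blocks := List.replicate p 1 ++ ((q : ℕ) + 1 - p) :: List.replicate (n - (q + 1)) 1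
  blocks_pos := by
    intro i hi
    simp only [List.mem_append, List.mem_cons, List.mem_replicate] at hi
    omega
  blocks_sum := by
    simp only [List.sum_append, List.sum_cons, List.sum_replicate, smul_eq_mul, mul_one]
    omega

section blockComp

variable {p q : Fin n} (hpq : p ≤ q)

theorem blockComp_blocksFun (v : Fin (blockComp p q hpq).length) :
    (blockComp p q hpq).blocksFun v = if (v : ℕ) = p then (q : ℕ) + 1 - p else 1 := by
  have hblocks : (blockComp p q hpq).blocks =
      List.replicate p 1 ++ ((q : ℕ) + 1 - p) :: List.replicate (n - (q + 1)) 1 := rfl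
  rw [Composition.blocksFun, List.get_eq_getElem, List.getElem_of_eq hblocks]
  simp only [List.getElem_append, List.length_replicate, List.getElem_replicate, List.getElem_cons]
  split_ifs <;> omega

theorem blockComp_sizeUpTo : (blockComp p q hpq).sizeUpTo p = p := by
  simp [Composition.sizeUpTo, blockComp]

theorem blockComp_ne_ones (hlt : p < q) : blockComp p q hlt.le ≠ Composition.ones n :=
  Composition.ne_ones_iff.2 ⟨(q : ℕ) + 1 - p, by simp [blockComp], by omega⟩

theorem blockComp_isMaximalFor (hp : l.1 p ≠ 0) (hq : l.1 q ≠ 0) :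
    IsMaximalFor (blockComp p q hpq) l := by
  intro v
  have hv := blockComp_blocksFun hpq v
  by_cases hvp : (v : ℕ) = p
  · rw [if_pos hvp] at hv
    have hfirst : firstPos (blockComp p q hpq) v = p := by
      ext
      simp only [firstPos, Composition.coe_embedding, hvp, blockComp_sizeUpTo, add_zero]
    have hlast : lastPos (blockComp p q hpq) v = q := by
      ext
      simp only [lastPos, Composition.coe_embedding, hv, hvp, blockComp_sizeUpTo]
      omega
    rw [hfirst, hlast]
    exact Or.inr ⟨hp, hq⟩
  · rw [if_neg hvp] at hv
    have hlast : lastPos (blockComp p q hpq) v = firstPos (blockComp p q hpq) v := by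
      ext
      simp only [lastPos, firstPos, Composition.coe_embedding, hv]
    rw [hlast, hv]
    tauto

theorem openOnColumns_blockComp {A : Matrix (Fin n) (Fin n) ℕ}
    (h : ∀ i k, i ≤ n → (p : ℕ) < k → k ≤ q →
      ne A i k = ne A i p ∨ ne A i k + ne A n (q + 1) = ne A i (q + 1) + ne A n k) :
    OpenOnColumns (blockComp p q hpq) A := by
  rw [openOnColumns_iff]
  intro v i k hi hfirst hlast
  have hsize := (blockComp p q hpq).sizeUpTo_succ' v
  rw [blockComp_blocksFun] at hsize
  by_cases hvp : (v : ℕ) = p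
  · have hsize_p := blockComp_sizeUpTo hpq
    rw [if_pos hvp, hvp, hsize_p, Nat.add_sub_cancel' (by omega)] at hsize
    rw [hvp, hsize] at hlast ⊢
    rw [hvp, hsize_p] at hfirst
    rw [hsize_p]
    rcases hfirst.eq_or_lt with rfl | hpk
    · exact Or.inl rfl
    rcases hlast.eq_or_lt with rfl | hkq
    · exact Or.inr rfl
    exact h i k hi hpk (Nat.le_of_lt_succ hkq)
  · rw [if_neg hvp] at hsize
    rcases hfirst.eq_or_lt with rfl | hlt
    · exact Or.inl rfl
    · obtain rfl : k = (blockComp p q hpq).sizeUpTo (v + 1) := by omega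
      exact Or.inr rfl

end blockComp

/-! ### Right multiplication strictly increases elements of `B^l` -/

theorem exists_consecutive_of_notMem_cbSet {C : Mat n r} (hro : ro C = l) (hco : co C = l)
    (hC : C ∉ cbSet l) :
    ∃ p q : Fin n, p < q ∧ l.1 p ≠ 0 ∧ l.1 q ≠ 0 ∧ (∀ m, p < m → m < q → l.1 m = 0) ∧
      0 < ne C.1 (p + 1) (p + 1) := by
  classical
  have hex : ∃ j, j ≤ n ∧ 0 < ne C.1 j j := by
    by_contra! hdiag
    exact hC (mem_cbSet_of_ne_self_eq_zero hro hco fun j hj => Nat.le_zero.1 (hdiag j hj))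
  obtain ⟨hj, hpos⟩ := Nat.find_spec hex
  have hmin : ∀ j, j < Nat.find hex → ¬(j ≤ n ∧ 0 < ne C.1 j j) := fun _ => Nat.find_min hex
  generalize Nat.find hex = j at hj hpos hmin
  obtain _ | j := j
  · simp [ne_zero_left] at hpos
  have hp : l.1 ⟨j, hj⟩ ≠ 0 := by
    intro hzero
    have hrow := ne_succ_le C ⟨j, hj⟩ j
    rw [hro, hzero] at hrow
    have hcol := ne_le_ne C.1 (le_refl (j + 1)) (Nat.le_succ j)
    exact hmin j j.lt_succ_self ⟨by omega, hpos.trans_le (hcol.trans hrow)⟩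
  obtain ⟨a, b, -, hjb, hab⟩ := exists_ne_zero_of_ne_pos hpos
  have hb : l.1 b ≠ 0 := hco ▸ co_ne_zero_iff.2 ⟨a, hab⟩
  obtain ⟨q, ⟨hpq, hq⟩, hqmin⟩ := wellFounded_lt.has_min {m : Fin n | ⟨j, hj⟩ < m ∧ l.1 m ≠ 0}
    ⟨b, hjb, hb⟩
  refine ⟨⟨j, hj⟩, q, hpq, hp, hq, fun m hpm hmq => ?_, hpos⟩
  by_contra hm
  exact hqmin m ⟨hpm, hm⟩ hmq

theorem ne_eq_or_of_prod_eq_self {A C : Mat n r} (h : co A = ro C) (hC : ro C = co C)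
    (hAC : prod A C h = A) {p q : Fin n} (hcol : ∀ m, p < m → m < q → (co A).1 m = 0)
    (hpos : 0 < ne C.1 (p + 1) (p + 1)) {i k : ℕ} (hi : i ≤ n) (hpk : (p : ℕ) < k) (hkq : k ≤ q) :
    ne A.1 i k = ne A.1 i p ∨
      ne A.1 i k + ne A.1 n (q + 1) = ne A.1 i (q + 1) + ne A.1 n k := by
  have hconst : ∀ i' k', (p : ℕ) < k' → k' ≤ q → ne A.1 i' (p + 1) = ne A.1 i' k' :=
    fun i' k' hpk' hk'q => ne_eq_ne_of_co_eq_zero hpk'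
      (fun b hpb hbk => hcol b hpb (Fin.lt_def.2 (by omega))) i'
  -- The alternatives correspond to whether the minimum defining the corner sum of `A · C` at
  -- `(i, p + 1)` is attained at some `s ≤ p` or at some `s > q`; `hpos` excludes `p < s ≤ q`.
  obtain ⟨s, hs, hprod⟩ := ne_prod_exists h (k := p + 1) hi p.2
  rw [hAC] at hprod
  rw [← hconst i k hpk hkq, ← hconst n k hpk hkq]
  by_cases hsp : s ≤ p
  · left
    have hsp' := ne_le_ne A.1 (le_refl i) hsp
    have hp := ne_le_ne A.1 (le_refl i) (Nat.le_succ p)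
    simp only [Nat.succ_eq_add_one] at hp
    omega
  by_cases hsq : s ≤ q
  · have hCs := ne_le_ne C.1 (show (p : ℕ) + 1 ≤ s by omega) (le_refl ((p : ℕ) + 1))
    have hAs := hconst i s (by omega) hsq
    omega
  · right
    have hcompl_s := ne_compl h hs
    have hcompl_p := ne_compl h (j := p + 1) p.2
    have hcompl_C := ne_compl hC.symm (j := p + 1) p.2
    have hmongeC := ne_monge C.1 hs (Nat.zero_le (p + 1))
    have hmongeA := ne_monge A.1 hi (show (p : ℕ) + 1 ≤ q + 1 by omega)
    have hmongeA' := ne_monge A.1 hi (show (q : ℕ) + 1 ≤ s by omega)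
    rw [ne_full'] at hmongeC
    omega

theorem lt_prod_of_mem_BSet {A C : Mat n r} (hA : A ∈ BSet l) (hco : co C = l)
    (hC : C ∉ cbSet l) (h : co A = ro C) : A < prod A C h := by
  have hro : ro C = l := h.symm.trans hA.1
  refine (le_prod_of_ro_eq_co h (hro.trans hco.symm)).lt_of_ne fun hAC => ?_
  obtain ⟨p, q, hpq, hp, hq, hcol, hpos⟩ := exists_consecutive_of_notMem_cbSet hro hco hC
  refine hA.2 (blockComp p q hpq.le) (blockComp_isMaximalFor _ hp hq) (blockComp_ne_ones hpq)
    (openOnColumns_blockComp _ fun i k => ?_)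
  exact ne_eq_or_of_prod_eq_self h (hro.trans hco.symm) hAC.symm (hA.1.symm ▸ hcol) hpos

theorem cbSet_subset_BSet (l : WeakComp n r) : cbSet l ⊆ BSet l := by
  refine fun A hA => ⟨hA.1, fun c hmax hne hopen => ?_⟩
  obtain ⟨s, hs, hs1⟩ := Composition.ne_ones_iff.1 hne
  obtain ⟨v, rfl⟩ := List.get_of_mem hs
  rcases hmax v with ⟨hone, -⟩ | ⟨hfirst, hlast⟩
  · exact hs1.ne' hone
  have hlt : firstPos c v < lastPos c v :=
    (c.embedding v).strictMono (Fin.lt_def.2 (Nat.sub_pos_of_lt hs1))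
  rw [← hA.1] at hfirst hlast
  obtain ⟨i, hi⟩ := co_ne_zero_iff.1 hfirst
  obtain ⟨i', hi'⟩ := co_ne_zero_iff.1 hlast
  have hii' : i < i' := by
    by_contra! hle
    exact hi' (hA.2 i _ (Nat.pos_of_ne_zero hi) i' _ hle hlt)
  have hzero := hopen v i i' _ _ hii' hlt
  simp only [colBlock, firstPos, lastPos, Composition.index_embedding, if_true] at hzero
  exact hzero.elim hi hi'

/-- The transposed matrix, the relative position of the same flags in the opposite order. -/
def transposeMat (A : Mat n r) : Mat n r :=
  ⟨A.1.transpose, Finset.sum_comm.trans A.2⟩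

theorem co_transposeMat (A : Mat n r) : co (transposeMat A) = ro A := rfl

theorem ne_transposeMat (A : Mat n r) {i : ℕ} (hi : i ≤ n) (k : ℕ) :
    ne (transposeMat A).1 k i + (ne A.1 i 0 + ne A.1 n k) = r + ne A.1 i k := by
  have hrect : ne (transposeMat A).1 k i = rect A.1 i n 0 k := by
    rw [ne, Finset.sum_comm]
    refine Finset.sum_congr rfl fun a _ => Finset.sum_congr rfl fun b _ => if_congr ?_ rfl rfl
    have := a.2
    omega
  rw [hrect, rect_add_ne A.1 hi (Nat.zero_le k), ne_full']

theorem transposeMat_prod_self {A : Mat n r} (hA : A ∈ cbSet l) :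
    prod (transposeMat A) A (co_transposeMat A) = diagMat l := by
  have hro : ro (prod (transposeMat A) A (co_transposeMat A)) = l := (ro_prod _).trans hA.1
  have hco : co (prod (transposeMat A) A (co_transposeMat A)) = l := (co_prod _).trans hA.1
  refine eq_of_mem_cbSet (mem_cbSet_of_ne_self_eq_zero hro hco fun j hj => ?_)
    (diagMat_mem_cbSet l) (hro.trans (ro_diag l).symm)
  obtain ⟨m, hm, hnorth, hsouth⟩ := (cb_iff A).1 hA.2 j hj
  have htranspose := ne_transposeMat A hm j
  have hle := ne_prod_le (co_transposeMat A) hj hm hj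
  omega

/-! ### The radical of `P_l` -/

/-- The basis element `k_l` of `P_l`, which generates it. -/
noncomputable def genP (l : WeakComp n r) : P l :=
  eP ⟨diagMat l, cbSet_subset_BSet l (diagMat_mem_cbSet l)⟩

theorem e_smul_genP (A : BSet l) : e A.1 • genP l = eP A := by
  have h : co A.1 = ro (diagMat l) := by rw [ro_diag, A.2.1]
  rw [genP, smul_def, incl_eP, e_mul_e, dif_pos h, prod_diag_right h, proj_e_mem A.2]

theorem eq_top_of_genP_mem {M : Submodule (Alg n r) (P l)} (h : genP l ∈ M) : M = ⊤ := by
  refine eq_top_iff.2 fun x _ => P_induction (p := (· ∈ M)) x M.zero_mem (fun _ _ => M.add_mem) ?_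
  intro c A
  exact M.smul_of_tower_mem c (e_smul_genP A ▸ M.smul_mem _ h)

/-- The coordinate of an element of `P_l` at a basis element. -/
noncomputable def coord (A : BSet l) : P l →ₗ[ℂ] ℂ :=
  (Finsupp.lapply A : (BSet l →₀ ℂ) →ₗ[ℂ] ℂ)

theorem coord_eP_self (A : BSet l) : coord A (eP A) = 1 :=
  Finsupp.single_eq_same

theorem coord_eP_of_ne {A B : BSet l} (h : A ≠ B) : coord A (eP B) = 0 :=
  Finsupp.single_eq_of_ne h

theorem mem_N_iff {x : P l} : x ∈ N l ↔ ∀ A : BSet l, A.1 ∈ cbSet l → coord A x = 0 := by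
  have hbasis : {x : P l | ∃ A : BSet l, A.1 ∉ cbSet l ∧ x = eP A} =
      (fun A => Finsupp.single A 1) '' {A : BSet l | A.1 ∉ cbSet l} :=
    Set.ext fun x => exists_congr fun A => and_congr_right fun _ => eq_comm
  rw [← SetLike.mem_coe, coe_N, hbasis, SetLike.mem_coe]
  change x ∈ Submodule.span (M := BSet l →₀ ℂ) ℂ _ ↔ _
  rw [← Finsupp.supported_eq_span_single]
  exact (Finsupp.mem_supported' ℂ x).trans (forall_congr' fun A => imp_congr_left not_not)

theorem eP_mem_N {A : BSet l} (hA : A.1 ∉ cbSet l) : eP A ∈ N l :=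
  mem_N_iff.2 fun _ hB => coord_eP_of_ne fun h => hA (h ▸ hB)

theorem genP_notMem_N (l : WeakComp n r) : genP l ∉ N l := fun h =>
  one_ne_zero ((coord_eP_self _).symm.trans (mem_N_iff.1 h _ (diagMat_mem_cbSet l)))

theorem smul_mem_of_mem_N {M : Submodule (Alg n r) (P l)} {a : Alg n r}
    (h : ∀ A : BSet l, A.1 ∉ cbSet l → a • eP A ∈ M) {y : P l} (hy : y ∈ N l) : a • y ∈ M := by
  rw [← SetLike.mem_coe, coe_N] at hy
  have hle : Submodule.span ℂ {x : P l | ∃ A : BSet l, A.1 ∉ cbSet l ∧ x = eP A} ≤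
      (M.restrictScalars ℂ).comap (Algebra.lsmul ℂ ℂ (P l) a) :=
    Submodule.span_le.2 fun _ ⟨A, hA, hx⟩ => hx ▸ h A hA
  exact hle hy

theorem transposeMat_smul_eP_sub_mem_N {A : BSet l} (hA : A.1 ∈ cbSet l) (B : BSet l) :
    e (transposeMat A.1) • eP B - coord A (eP B) • genP l ∈ N l := by
  by_cases hAB : A = B
  · subst hAB
    rw [coord_eP_self, one_smul, smul_def, incl_eP, e_mul_e, dif_pos (co_transposeMat A.1),
      transposeMat_prod_self hA, proj_e_mem (cbSet_subset_BSet l (diagMat_mem_cbSet l)), genP,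
      sub_self]
    exact Submodule.zero_mem _
  rw [coord_eP_of_ne hAB, zero_smul, sub_zero]
  by_cases hB : B.1 ∈ cbSet l
  · have hro : ¬ co (transposeMat A.1) = ro B.1 := fun hro =>
      hAB (Subtype.ext (eq_of_mem_cbSet hA hB hro))
    rw [smul_def, incl_eP, e_mul_e, dif_neg hro, map_zero]
    exact Submodule.zero_mem _
  · exact Submodule.smul_mem _ _ (eP_mem_N hB)

theorem transposeMat_smul_sub_mem_N {A : BSet l} (hA : A.1 ∈ cbSet l) (x : P l) :
    e (transposeMat A.1) • x - coord A x • genP l ∈ N l := by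
  let f : P l →ₗ[ℂ] P l :=
    Algebra.lsmul ℂ ℂ (P l) (e (transposeMat A.1)) - (coord A).smulRight (genP l)
  change f x ∈ N l
  refine P_induction (p := fun x => f x ∈ N l) x ?_ ?_ ?_
  · rw [map_zero]
    exact Submodule.zero_mem _
  · intro x y hx hy
    rw [map_add]
    exact Submodule.add_mem _ hx hy
  · intro c B
    rw [map_smul]
    exact (N l).smul_of_tower_mem c (transposeMat_smul_eP_sub_mem_N hA B)

theorem isCoatom_N (l : WeakComp n r) : IsCoatom (N l) := by
  refine ⟨fun h => genP_notMem_N l (h ▸ Submodule.mem_top), fun M hM => ?_⟩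
  obtain ⟨x, hxM, hxN⟩ := SetLike.exists_of_lt hM
  obtain ⟨A, hA, hAx⟩ : ∃ A : BSet l, A.1 ∈ cbSet l ∧ coord A x ≠ 0 := by
    simpa only [mem_N_iff, not_forall, exists_prop] using hxN
  have hsmul : coord A x • genP l ∈ M :=
    (M.sub_mem_iff_right (M.smul_mem _ hxM)).1 (hM.le (transposeMat_smul_sub_mem_N hA x))
  refine eq_top_of_genP_mem ?_
  rw [← inv_smul_smul₀ hAx (genP l)]
  exact M.smul_of_tower_mem _ hsmul

theorem eP_mem_of_genP_sub_mem {M : Submodule (Alg n r) (P l)} {y : P l} (hy : y ∈ N l)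
    (hM : genP l - y ∈ M) (A : BSet l) : eP A ∈ M := by
  induction A using WellFoundedGT.induction with
  | ind A ih =>
    have hsub : eP A - e A.1 • y ∈ M := by
      rw [← e_smul_genP A, ← smul_sub]
      exact M.smul_mem _ hM
    refine (M.sub_mem_iff_left (smul_mem_of_mem_N (fun C hC => ?_) hy)).1 hsub
    rw [e_smul_eP]
    split_ifs with h
    · exact ih ⟨_, h.2⟩ (lt_prod_of_mem_BSet A.2 C.2.1 hC h.1)
    · exact M.zero_mem

theorem eq_top_of_sup_N_eq_top {M : Submodule (Alg n r) (P l)} (h : M ⊔ N l = ⊤) : M = ⊤ := by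
  obtain ⟨x, hx, y, hy, hxy⟩ := Submodule.mem_sup.1 (h ▸ Submodule.mem_top : genP l ∈ M ⊔ N l)
  refine eq_top_of_genP_mem (eP_mem_of_genP_sub_mem hy ?_ _)
  rwa [← hxy, add_sub_cancel_right]

theorem eq_jacobson_of_isCoatom_of_superfluous {R M : Type*} [Ring R] [AddCommGroup M] [Module R M]
    {K : Submodule R M} (hK : IsCoatom K) (hsup : ∀ L : Submodule R M, L ⊔ K = ⊤ → L = ⊤) :
    K = Module.jacobson R M := by
  refine le_antisymm (le_sInf fun L hL => ?_) (sInf_le hK)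
  by_contra hKL
  exact hL.1 (hsup L (hL.2 _ (left_lt_sup.2 hKL)))

theorem N_eq_jacobson (l : WeakComp n r) : N l = Module.jacobson (Alg n r) (P l) :=
  eq_jacobson_of_isCoatom_of_superfluous (isCoatom_N l) fun _ => eq_top_of_sup_N_eq_top

end SchurZero

theorem mainTheorem2_general (n r : ℕ) (l : SchurZero.WeakComp n r) :
    SchurZero.N l = Module.jacobson (SchurZero.Alg n r) (SchurZero.P l) ∧
      ∃ φ : SchurZero.S l ≃ₗ[SchurZero.Alg n r]
          SchurZero.top (SchurZero.Alg n r) (SchurZero.P l),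
        ∀ x : SchurZero.P l, φ (Submodule.Quotient.mk x) = Submodule.Quotient.mk x :=
  have h := SchurZero.N_eq_jacobson l
  ⟨h, Submodule.quotEquivOfEq _ _ h, Submodule.quotEquivOfEq_mk _ _ h⟩

theorem mainTheorem2 (n r : ℕ) (l : SchurZero.WeakComp n r) (hl : l.IsBullet) :
    SchurZero.N l = Module.jacobson (SchurZero.Alg n r) (SchurZero.P l) ∧
      ∃ φ : SchurZero.S l ≃ₗ[SchurZero.Alg n r]
          SchurZero.top (SchurZero.Alg n r) (SchurZero.P l),
        ∀ x : SchurZero.P l, φ (Submodule.Quotient.mk x) = Submodule.Quotient.mk x :=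
  mainTheorem2_general n r l
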